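/- Let $m\ge 1$ be an integer. For functions of $r\in(0,\infty)$ write $\int f=2\pi\int_0^\infty f\,r\,dr$, $\|f\|_{L^2}^2=\int|f|^2$, and $$Q(r)=\sqrt8\,(m+1)\frac{r^m}{1+r^{2(m+1)}},\qquad A_\theta[u](r)=-\tfrac12\int_0^r|u|^2r'\,dr',\qquad D_+^{(u)}f=\partial_rf-\frac{m+A_\theta[u]}{r}f .$$ Let $L_Qf=D_+^{(Q)}f+\frac{Q}{r}\int_0^rQf\,r'\,dr'$ and $L_Q^*f=-\partial_rf-\frac{1+m+A_\theta[Q]}{r}f+Q\int_r^\infty Qf\,dr'$. Then there is a smooth real function $\rho$ on $(0,\infty)$ with $L_Q^*L_Q\rho=Q$, $L_Q\rho=\frac{1}{2(m+1)}rQ$ and $|\rho|\lesssim r^2Q$. Moreover, there exist $B>1$, $\eta^{**}>0$ and families $\{Q^{(\eta)}\}_{\eta\in[0,\eta^{**}]}$, $\{P^{(\eta)}\}_{\eta\in[0,\eta^{**}]}$ of smooth real-valued functions on $(0,\infty)$, with $P^{(\eta)}>0$ and $Q^{(\eta)}\in L^2$ (and hence $Q^{(\eta)}-Q\in L^2$),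 such that the following hold, where $R_\eta=(B\eta)^{-1/2}$ for $\eta>0$ and $R_0=+\infty$, where all implicit constants are independent of $\eta\in[0,\eta^{**}]$ and $r>0$, and where $o(\eta)$ refers to $\eta\to0^+$. 1. $D_+^{(Q^{(\eta)})}P^{(\eta)}=0$, $Q^{(\eta)}=e^{-\eta r^2/4}P^{(\eta)}$, and $Q^{(0)}=P^{(0)}=Q$. 2. For $\ell\in\{0,1\}$, $$|\partial_r^\ell Q^{(\eta)}(r)|\lesssim \mathbf 1_{r\le R_\eta}\,r^{-\ell}Q(r)+\mathbf 1_{r\ge R_\eta}\,R_\eta^{-\ell}Q(R_\eta)\,e^{-\eta r^2/4};$$ in particular $\sup_{\eta\in[0,\eta^{**}]}|\partial_r^\ell Q^{(\eta)}(r)|\lesssim r^{-\ell}Q(r)$. 3. $|Q^{(\eta)}-Q+\eta(m+1)\rho|\lesssim\eta^2r^4Q$ for all $0<r\le R_\eta$ (for all $0<r<\infty$ if $\eta=0$). 4. $\int|Q^{(\eta)}|^2=\int|Q|^2-\frac{\eta}{2(m+1)}\int|rQ|^2+o(\eta)$; in particular $\theta_\eta:=\frac1{4\pi}\int|Q^{(\eta)}|^2-(m+1)$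 satisfies $\theta_\eta=(m+1)-\frac{\eta}{8\pi(m+1)}\int|rQ|^2+o(\eta)$. 5. For every $\eta\in[0,\eta^{**}]$ the limit $\lim_{r\to\infty}\frac{\log P^{(\eta)}(r)}{\log r}$ exists, and it equals $-(m+2)+\frac{\eta}{8\pi(m+1)}\int|rQ|^2+o(\eta)$; in particular, for $0<\eta\le\eta^{**}$ it is larger than $-(m+2)$, i.e. $P^{(\eta)}$ decays more slowly than $Q$. 6. $\|Q^{(\eta)}-Q\|_{L^2}\lesssim\eta|\log\eta|^{1/2}$ if $m=1$ (the right side being $0$ at $\eta=0$), and $\|Q^{(\eta)}-Q\|_{L^2}\lesssim\eta$ if $m\ge2$. -/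

import Mathlib

open Set Filter Topology MeasureTheory Asymptotics
open scoped ContDiff

noncomputable section

namespace CSS

/-- The radial static profile `Q(r) = √8 (m+1) r^m / (1 + r^(2(m+1)))` of equivariance index `m`. -/
def Q (m : ℕ) (r : ℝ) : ℝ :=
  √8 * ((m : ℝ) + 1) * r ^ m / (1 + r ^ (2 * (m + 1)))

/-- The integral over the plane of a radial function: `2π ∫_0^∞ f(r) r dr`. -/
def planeIntegral (f : ℝ → ℝ) : ℝ :=
  2 * Real.pi * ∫ r in Ioi (0 : ℝ), f r * r

/-- A real radial profile is square integrable over the plane. -/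
def SquareIntegrable (f : ℝ → ℝ) : Prop :=
  IntegrableOn (fun r => |f r| ^ 2 * r) (Ioi (0 : ℝ))

/-- The `L²` norm over the plane of a real radial profile. -/
def l2norm (f : ℝ → ℝ) : ℝ :=
  √(planeIntegral fun r => |f r| ^ 2)

/-- The gauge potential `A_θ[u](r) = -(1/2) ∫_0^r |u|² r' dr'`. -/
def Atheta (u : ℝ → ℝ) (r : ℝ) : ℝ :=
  -(1 / 2) * ∫ s in (0 : ℝ)..r, |u s| ^ 2 * s

/-- The radial Bogomol'nyi operator `D_+^{(u)} f = ∂_r f - (m + A_θ[u]) / r · f`. -/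
def Dplus (m : ℕ) (u f : ℝ → ℝ) (r : ℝ) : ℝ :=
  deriv f r - ((m : ℝ) + Atheta u r) / r * f r

/-- Its formal `L²` adjoint `D_+^{(u)*} f = -∂_r f - (1 + m + A_θ[u]) / r · f`. -/
def DplusAdj (m : ℕ) (u f : ℝ → ℝ) (r : ℝ) : ℝ :=
  -deriv f r - (1 + (m : ℝ) + Atheta u r) / r * f r

/-- `B_f g = (1/r) ∫_0^r f g r' dr'` for real profiles. -/
def Bop (f g : ℝ → ℝ) (r : ℝ) : ℝ :=
  1 / r * ∫ s in (0 : ℝ)..r, f s * g s * s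

/-- The formal adjoint `B_w^* f = w ∫_r^∞ f dr'` for real profiles. -/
def BopAdj (w f : ℝ → ℝ) (r : ℝ) : ℝ :=
  w r * ∫ s in Ioi r, f s

/-- The linearized Bogomol'nyi operator `L_w = D_+^{(w)} + w B_w`. -/
def Lop (m : ℕ) (w f : ℝ → ℝ) (r : ℝ) : ℝ :=
  Dplus m w f r + w r * Bop w f r

/-- The formal adjoint `L_w^* f = D_+^{(w)*} f + B_w^* (w f)`. -/
def LopAdj (m : ℕ) (w f : ℝ → ℝ) (r : ℝ) : ℝ :=
  DplusAdj m w f r + BopAdj w (fun s => w s * f s) r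

/-- `ρ` is the generalized eigenmode: a smooth real function on `(0,∞)` with `L_Q^* L_Q ρ = Q`,
`L_Q ρ = r Q / (2(m+1))` and `|ρ| ≲ r² Q`. These conditions determine `ρ` on `(0,∞)`. -/
structure IsGeneralizedMode (m : ℕ) (ρ : ℝ → ℝ) : Prop where
  smooth : ContDiffOn ℝ ∞ ρ (Ioi 0)
  eqn : ∀ r > 0, LopAdj m (Q m) (Lop m (Q m) ρ) r = Q m r
  first_order : ∀ r > 0, Lop m (Q m) ρ r = 1 / (2 * ((m : ℝ) + 1)) * (r * Q m r)
  bound : ∃ C : ℝ, ∀ r > 0, |ρ r| ≤ C * (r ^ 2 * Q m r)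

/-- The radius `R_η = (B η)^(-1/2)`, used for `η > 0` (for `η = 0` it is `+∞`, see below). -/
def Rad (B η : ℝ) : ℝ := (B * η) ^ (-(1 / 2) : ℝ)

/-- The set of `r > 0` with `r ≤ R_η`, where `R_0 = +∞`. -/
def inner (B η : ℝ) : Set ℝ := {r | 0 < r ∧ (η = 0 ∨ r ≤ Rad B η)}

/-- The set of finite `r` with `r ≥ R_η`, where `R_0 = +∞`. -/
def outer (B η : ℝ) : Set ℝ := {r | 0 < η ∧ Rad B η ≤ r}

/-- `θ = (1/4π) ∫ |u|² - (m+1)`. -/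
def theta (m : ℕ) (u : ℝ → ℝ) : ℝ :=
  1 / (4 * Real.pi) * planeIntegral (fun r => |u r| ^ 2) - ((m : ℝ) + 1)

end CSS

end

noncomputable section

namespace CSS

/-! Write P = Q e^{φ/2} and Q^{(η)} = Q e^{(φ - η r²/2)/2}. Since Q is itself annihilated by its own
D_+, the nonlocal equation for P becomes the scalar Volterra equation r φ' = -∫_0^r s Q² (e^{φ - η
s²/2} - 1) ds with φ(0) = 0 (`IsPerturbation`). Everything is read off φ.

Existence: with e^x cut off at x = 1 the nonlinearity is globally Lipschitz, and a contraction in an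
exponentially weighted sup norm gives a global solution (`exists_isPerturbation`). Because Q has
finite mass, a Gronwall argument in the variable ∫_0^r s Q² gives |φ| ≲ η r² with a constant
independent of r (`abs_le_of_volterra`). For m ≥ 1 the moment ∫ r³ Q² is finite, so |φ'| ≲ η/r.
Hence φ grows at most like η log r, stays below 1 + η r²/4 for small η, and the cutoff is never
active (`exists_profile`).

First variation: the linear equation (F = id, η = 1) yields φ₁, and ρ = -Q (φ₁ - r²/2) / (2(m+1)) is
the generalized mode. The same Gronwall argument gives φ = η φ₁ + O(η² r⁴), which is the expansion
of Q^{(η)}.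

Mass and decay: with d the limit of m + A_θ, which is the decay exponent of P, a Pohozaev identity
gives 2(1+d)² + η ∫ r³ |Q^{(η)}|² = 2(m+1)². As d ≤ -3/2, the root near -(m+2) is selected, and
convergence of the moment gives its first-order expansion. The mass is 4π(m - d), so items 4 and 5
are the same statement.

The L² bound follows from |Q^{(η)} - Q| ≲ min(η r², 1) Q; for m = 1 the integral of r⁵ Q² diverges
logarithmically, whence the logarithm. -/

/-- The mass of `Q` in the disc of radius `r`: `∫_0^r s Q(s)² ds`, in closed form. -/
def massQ (m : ℕ) (r : ℝ) : ℝ :=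
  4 * ((m : ℝ) + 1) * r ^ (2 * (m + 1)) / (1 + r ^ (2 * (m + 1)))

/-! ### The profile Q: bounds, mass function and logarithmic derivative -/

lemma pow_even_nonneg (m : ℕ) (r : ℝ) : 0 ≤ r ^ (2 * (m + 1)) := by
  rw [pow_mul]; positivity

lemma one_add_pow_pos (m : ℕ) (r : ℝ) : 0 < 1 + r ^ (2 * (m + 1)) := by
  have := pow_even_nonneg m r
  linarith

lemma Q_contDiff (m : ℕ) : ContDiff ℝ ∞ (Q m) := by
  unfold Q
  refine ContDiff.div (by fun_prop) (by fun_prop) fun r => (one_add_pow_pos m r).ne'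

lemma Q_continuous (m : ℕ) : Continuous (Q m) := (Q_contDiff m).continuous

lemma Q_pos (m : ℕ) {r : ℝ} (hr : 0 < r) : 0 < Q m r := by
  unfold Q; positivity

lemma Q_nonneg (m : ℕ) {r : ℝ} (hr : 0 ≤ r) : 0 ≤ Q m r := by
  unfold Q; positivity

lemma Q_sq (m : ℕ) (r : ℝ) :
    Q m r ^ 2 = 8 * ((m : ℝ) + 1) ^ 2 * r ^ (2 * m) / (1 + r ^ (2 * (m + 1))) ^ 2 := by
  unfold Q
  rw [div_pow, mul_pow, mul_pow, Real.sq_sqrt (by norm_num), ← pow_mul, mul_comm m 2]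

lemma Q_sq_le (m : ℕ) {r : ℝ} (hr : 0 ≤ r) : Q m r ^ 2 ≤ 8 * ((m : ℝ) + 1) ^ 2 := by
  rw [Q_sq, div_le_iff₀ (pow_pos (one_add_pow_pos m r) 2)]
  have h1 : r ^ (2 * m) ≤ (1 + r ^ (2 * (m + 1))) ^ 2 := by
    have h0 := pow_even_nonneg m r
    rcases le_total r 1 with h | h
    · have : r ^ (2 * m) ≤ 1 := pow_le_one₀ hr h
      nlinarith
    · have : r ^ (2 * m) ≤ r ^ (2 * (m + 1)) := pow_le_pow_right₀ h (by omega)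
      nlinarith
  gcongr

lemma Q_sq_mul_pow_le (m : ℕ) {r : ℝ} (hr : 0 ≤ r) :
    r ^ (2 * m + 4) * Q m r ^ 2 ≤ 8 * ((m : ℝ) + 1) ^ 2 := by
  rw [Q_sq, mul_div_assoc', div_le_iff₀ (pow_pos (one_add_pow_pos m r) 2)]
  have h0 := pow_even_nonneg m r
  have h1 : r ^ (2 * m + 4) * r ^ (2 * m) = (r ^ (2 * (m + 1))) ^ 2 := by ring
  have h2 : (r ^ (2 * (m + 1))) ^ 2 ≤ (1 + r ^ (2 * (m + 1))) ^ 2 := by gcongr; linarith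
  calc r ^ (2 * m + 4) * (8 * ((m : ℝ) + 1) ^ 2 * r ^ (2 * m))
      = 8 * ((m : ℝ) + 1) ^ 2 * (r ^ (2 * m + 4) * r ^ (2 * m)) := by ring
    _ ≤ _ := by rw [h1]; gcongr

/-- Q² decays like r^{-(2m+4)}; all integrability thresholds below come from this trade of p powers
of growth for j powers of decay. -/
lemma pow_mul_Q_sq_le (m p j : ℕ) (hp : p + j ≤ 2 * m + 4) {r : ℝ} (hr : 1 ≤ r) :
    r ^ p * Q m r ^ 2 ≤ 8 * ((m : ℝ) + 1) ^ 2 * (r ^ j)⁻¹ := by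
  have h0 : 0 < r := by linarith
  rw [← div_eq_mul_inv, le_div_iff₀ (by positivity)]
  refine le_trans ?_ (Q_sq_mul_pow_le m h0.le)
  rw [mul_right_comm, ← pow_add]
  gcongr

lemma integrableOn_inv_pow {a : ℝ} (ha : 0 < a) (j : ℕ) (hj : 2 ≤ j) :
    IntegrableOn (fun r : ℝ => (r ^ j)⁻¹) (Ioi a) := by
  have h2 : (2 : ℝ) ≤ j := by exact_mod_cast hj
  refine (integrableOn_Ioi_rpow_of_lt (a := -(j : ℝ)) (by linarith) ha).congr_fun ?_
    measurableSet_Ioi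
  intro r hr
  have : 0 < r := ha.trans hr
  simp [Real.rpow_neg this.le]

lemma integrableOn_pow_mul_Q_sq (m p : ℕ) (hp : p ≤ 2 * m + 2) :
    IntegrableOn (fun r => r ^ p * Q m r ^ 2) (Ioi (0 : ℝ)) := by
  have hc : Continuous (fun r => r ^ p * Q m r ^ 2) :=
    (continuous_pow p).mul ((Q_continuous m).pow 2)
  rw [← Ioc_union_Ioi_eq_Ioi (zero_le_one : (0 : ℝ) ≤ 1)]
  refine IntegrableOn.union ?_ ?_
  · exact (hc.integrableOn_Icc).mono_set Ioc_subset_Icc_self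
  · refine Integrable.mono' ((integrableOn_inv_pow one_pos 2 le_rfl).const_mul
      (8 * ((m : ℝ) + 1) ^ 2)) hc.aestronglyMeasurable.restrict ?_
    refine (ae_restrict_mem measurableSet_Ioi).mono fun r hr => ?_
    have hr1 : (1 : ℝ) ≤ r := le_of_lt hr
    rw [Real.norm_of_nonneg (by positivity)]
    exact pow_mul_Q_sq_le m p 2 (by omega) hr1

lemma hasDerivAt_massQ (m : ℕ) (r : ℝ) : HasDerivAt (massQ m) (r * Q m r ^ 2) r := by
  have hp := one_add_pow_pos m r
  have h1 : HasDerivAt (fun r : ℝ => r ^ (2 * (m + 1)))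
      (2 * ((m : ℝ) + 1) * r ^ (2 * m + 1)) r := by
    have := hasDerivAt_pow (2 * (m + 1)) r
    rw [show 2 * (m + 1) - 1 = 2 * m + 1 by omega] at this
    refine this.congr_deriv ?_
    push_cast; ring
  have h2 := (h1.const_mul (4 * ((m : ℝ) + 1))).div (h1.const_add 1) hp.ne'
  refine h2.congr_deriv ?_
  rw [Q_sq]
  field_simp
  ring

lemma massQ_zero (m : ℕ) : massQ m 0 = 0 := by
  simp [massQ]

lemma massQ_nonneg (m : ℕ) (r : ℝ) : 0 ≤ massQ m r := by
  have := pow_even_nonneg m r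
  unfold massQ; positivity

lemma massQ_le (m : ℕ) (r : ℝ) : massQ m r ≤ 4 * ((m : ℝ) + 1) := by
  have := pow_even_nonneg m r
  unfold massQ
  rw [div_le_iff₀ (one_add_pow_pos m r)]
  nlinarith [(by positivity : (0 : ℝ) ≤ m)]

lemma massQ_eq (m : ℕ) (r : ℝ) :
    massQ m r = 4 * ((m : ℝ) + 1) - 4 * ((m : ℝ) + 1) / (1 + r ^ (2 * (m + 1))) := by
  have := (one_add_pow_pos m r).ne'
  unfold massQ
  field_simp
  ring

lemma continuous_massQ (m : ℕ) : Continuous (massQ m) :=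
  continuous_iff_continuousAt.2 fun r => (hasDerivAt_massQ m r).continuousAt

lemma massQ_monotoneOn (m : ℕ) : MonotoneOn (massQ m) (Ici 0) := by
  refine monotoneOn_of_deriv_nonneg (convex_Ici 0) (continuous_massQ m).continuousOn
    (fun r _ => (hasDerivAt_massQ m r).differentiableAt.differentiableWithinAt) ?_
  intro r hr
  rw [interior_Ici] at hr
  have : 0 < r := hr
  rw [(hasDerivAt_massQ m r).deriv]
  positivity

lemma integral_Q_sq (m : ℕ) (r : ℝ) : ∫ s in (0 : ℝ)..r, s * Q m s ^ 2 = massQ m r := by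
  rw [intervalIntegral.integral_eq_sub_of_hasDerivAt (fun s _ => hasDerivAt_massQ m s),
    massQ_zero, sub_zero]
  exact (continuous_id.mul ((Q_continuous m).pow 2)).intervalIntegrable _ _

lemma tendsto_massQ (m : ℕ) : Tendsto (massQ m) atTop (𝓝 (4 * ((m : ℝ) + 1))) := by
  have h1 : Tendsto (fun r : ℝ => 1 + r ^ (2 * (m + 1))) atTop atTop :=
    tendsto_atTop_add_const_left _ _ (tendsto_pow_atTop (by omega))
  have h2 := (tendsto_const_nhds (x := 4 * ((m : ℝ) + 1))).sub
    ((tendsto_const_nhds (x := 4 * ((m : ℝ) + 1))).div_atTop h1)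
  rw [sub_zero] at h2
  exact h2.congr fun r => (massQ_eq m r).symm

/-- This is the self-duality of Q: since A_θ[Q] = -`massQ`/2, it says D_+^{(Q)} Q = 0. -/
lemma hasDerivAt_Q (m : ℕ) {r : ℝ} (hr : 0 < r) :
    HasDerivAt (Q m) (((m : ℝ) - massQ m r / 2) / r * Q m r) r := by
  have hp := one_add_pow_pos m r
  have h1 : HasDerivAt (fun r : ℝ => r ^ (2 * (m + 1)))
      (2 * ((m : ℝ) + 1) * r ^ (2 * (m + 1)) / r) r := by
    have := hasDerivAt_pow (2 * (m + 1)) r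
    rw [show 2 * (m + 1) - 1 = 2 * m + 1 by omega] at this
    refine this.congr_deriv ?_
    field_simp
    push_cast; ring
  have h0 : HasDerivAt (fun r : ℝ => r ^ m) ((m : ℝ) * r ^ m / r) r := by
    refine (hasDerivAt_pow m r).congr_deriv ?_
    rcases m with _ | m
    · simp
    · field_simp
      simp [pow_succ]
  have h2 := (h0.const_mul (√8 * ((m : ℝ) + 1))).div (h1.const_add 1) hp.ne'
  refine h2.congr_deriv ?_
  unfold massQ Q
  field_simp
  ring

/-! ### Global solvability of the radial equation by a weighted contraction -/

open scoped NNReal BoundedContinuousFunction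

/-- The function `u⁻¹ ∫_0^u s Q(s)² b(s) ds`, in a rescaled form that is continuous at `u = 0`. -/
def radialMean (m : ℕ) (b : ℝ → ℝ) (u : ℝ) : ℝ :=
  u * ∫ σ in (0 : ℝ)..1, σ * Q m (u * σ) ^ 2 * b (u * σ)

lemma radialMean_eq (m : ℕ) (b : ℝ → ℝ) {u : ℝ} (hu : u ≠ 0) :
    radialMean m b u = u⁻¹ * ∫ s in (0 : ℝ)..u, s * Q m s ^ 2 * b s := by
  have h := intervalIntegral.mul_integral_comp_mul_left (a := 0) (b := 1)
    (f := fun s => s * Q m s ^ 2 * b s) u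
  simp only [mul_zero, mul_one] at h
  rw [← h, radialMean, inv_mul_cancel_left₀ hu, ← intervalIntegral.integral_const_mul]
  refine intervalIntegral.integral_congr fun σ _ => ?_
  ring

lemma continuous_radialMean (m : ℕ) {b : ℝ → ℝ} (hb : Continuous b) :
    Continuous (radialMean m b) := by
  unfold radialMean
  refine continuous_id.mul ?_
  refine intervalIntegral.continuous_parametric_intervalIntegral_of_continuous' ?_ 0 1
  have := Q_continuous m
  simp only [Function.uncurry_def]
  fun_prop

lemma radialMean_sub (m : ℕ) {b c : ℝ → ℝ} (hb : Continuous b) (hc : Continuous c) (u : ℝ) :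
    radialMean m b u - radialMean m c u = radialMean m (fun s => b s - c s) u := by
  have := Q_continuous m
  unfold radialMean
  rw [← mul_sub, ← intervalIntegral.integral_sub]
  · congr 1
    refine intervalIntegral.integral_congr fun σ _ => ?_
    ring
  · exact Continuous.intervalIntegrable (by fun_prop) _ _
  · exact Continuous.intervalIntegrable (by fun_prop) _ _

lemma integral_exp_mul {l : ℝ} (hl : 0 < l) (a r : ℝ) :
    ∫ u in a..r, Real.exp (l * u) = (Real.exp (l * r) - Real.exp (l * a)) / l := by
  rw [intervalIntegral.integral_eq_sub_of_hasDerivAt (f := fun u => Real.exp (l * u) / l)]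
  · ring
  · intro u _
    have := ((hasDerivAt_id u).const_mul l).exp.div_const l
    refine this.congr_deriv ?_
    simp
    field_simp
  · exact Continuous.intervalIntegrable (by fun_prop) _ _

lemma abs_radialMean_le (m : ℕ) {b : ℝ → ℝ} {D l : ℝ} (hl : 0 < l) (hD : 0 ≤ D)
    (h : ∀ s, 0 ≤ s → |b s| ≤ D * Real.exp (l * s)) {u : ℝ} (hu : 0 ≤ u) :
    |radialMean m b u| ≤ 8 * ((m : ℝ) + 1) ^ 2 * D / l * Real.exp (l * u) := by
  rcases hu.eq_or_lt with rfl | hu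
  · simp only [radialMean, zero_mul, abs_zero]; positivity
  rw [radialMean_eq m b hu.ne', abs_mul, abs_of_pos (inv_pos.2 hu)]
  have h1 : |∫ s in (0 : ℝ)..u, s * Q m s ^ 2 * b s| ≤
      ∫ s in (0 : ℝ)..u, u * (8 * ((m : ℝ) + 1) ^ 2) * D * Real.exp (l * s) := by
    rw [← Real.norm_eq_abs]
    refine intervalIntegral.norm_integral_le_of_norm_le (g := fun s =>
      u * (8 * ((m : ℝ) + 1) ^ 2) * D * Real.exp (l * s)) hu.le ?_
      (Continuous.intervalIntegrable (μ := volume) (by fun_prop) _ _)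
    refine Eventually.of_forall fun s hs => ?_
    have hs0 : 0 ≤ s := hs.1.le
    rw [Real.norm_eq_abs, abs_mul, abs_mul, abs_of_nonneg hs0, abs_of_nonneg (sq_nonneg _),
      mul_assoc (u * _)]
    exact mul_le_mul (mul_le_mul hs.2 (Q_sq_le m hs0) (sq_nonneg _) hu.le) (h s hs0)
      (abs_nonneg _) (by positivity)
  rw [intervalIntegral.integral_const_mul, integral_exp_mul hl] at h1
  calc u⁻¹ * |∫ s in (0 : ℝ)..u, s * Q m s ^ 2 * b s|
      ≤ u⁻¹ * (u * (8 * ((m : ℝ) + 1) ^ 2) * D * ((Real.exp (l * u) - Real.exp (l * 0)) / l)) := by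
        gcongr
    _ = 8 * ((m : ℝ) + 1) ^ 2 * D / l * (Real.exp (l * u) - 1) := by
        rw [mul_zero, Real.exp_zero]; field_simp
    _ ≤ _ := by gcongr; linarith

/-- Each of the two integrations of e^{ls} gains a factor 1/l, so a large weight exponent makes the
solution map contracting. -/
lemma abs_integral_radialMean_le (m : ℕ) {b : ℝ → ℝ} {D l : ℝ} (hl : 0 < l) (hD : 0 ≤ D)
    (h : ∀ s, 0 ≤ s → |b s| ≤ D * Real.exp (l * s)) {r : ℝ} (hr : 0 ≤ r) :
    |∫ u in (0 : ℝ)..r, radialMean m b u| ≤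
      8 * ((m : ℝ) + 1) ^ 2 * D / l ^ 2 * Real.exp (l * r) := by
  have h1 : |∫ u in (0 : ℝ)..r, radialMean m b u| ≤
      ∫ u in (0 : ℝ)..r, 8 * ((m : ℝ) + 1) ^ 2 * D / l * Real.exp (l * u) := by
    rw [← Real.norm_eq_abs]
    refine intervalIntegral.norm_integral_le_of_norm_le hr
      (Eventually.of_forall fun s hs => abs_radialMean_le m hl hD h hs.1.le) ?_
    exact Continuous.intervalIntegrable (by fun_prop) _ _
  rw [intervalIntegral.integral_const_mul, integral_exp_mul hl] at h1
  refine h1.trans ?_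
  rw [show 8 * ((m : ℝ) + 1) ^ 2 * D / l * ((Real.exp (l * r) - Real.exp (l * 0)) / l) =
    8 * ((m : ℝ) + 1) ^ 2 * D / l ^ 2 * (Real.exp (l * r) - Real.exp (l * 0)) by
      field_simp]
  gcongr
  linarith [Real.exp_pos (l * 0)]

/-- `φ` solves the radial equation `r φ' = -∫_0^r s Q² F(φ - η s²/2) ds`, `φ(0) = 0`. -/
structure IsPerturbation (m : ℕ) (F : ℝ → ℝ) (η : ℝ) (φ : ℝ → ℝ) : Prop where
  continuous : Continuous φ
  zero : φ 0 = 0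
  hasDerivAt : ∀ r > 0, HasDerivAt φ
    (-(r⁻¹ * ∫ s in (0 : ℝ)..r, s * Q m s ^ 2 * F (φ s - η * s ^ 2 / 2))) r

theorem exists_isPerturbation (m : ℕ) {F : ℝ → ℝ} {L : ℝ≥0} (hF : LipschitzWith L F)
    (hF0 : F 0 = 0) {η : ℝ} (hη : 0 ≤ η) : ∃ φ, IsPerturbation m F η φ := by
  set c : ℝ := 8 * ((m : ℝ) + 1) ^ 2 with hc
  have hc0 : 0 < c := by positivity
  -- The summand 2cL forces the contraction factor cL/l² below 1/2; the summand 1 lets e^{ls}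
  -- dominate s²/2.
  set l : ℝ := 1 + 2 * c * L with hl_def
  have hcL : 0 ≤ c * L := by positivity
  have hl1 : 1 ≤ l := by linarith
  have hl : 0 < l := by linarith
  have hcl : c * L / l ^ 2 ≤ 1 / 2 := by
    rw [div_le_iff₀ (by positivity)]
    nlinarith
  have hFc := hF.continuous
  have hFle : ∀ x y, |F x - F y| ≤ L * |x - y| := fun x y => by
    simpa [Real.dist_eq] using hF.dist_le_mul x y
  -- The unknown is the bounded function g with φ(s) = e^{ls} g(s).
  let b : (ℝ →ᵇ ℝ) → ℝ → ℝ := fun g s => F (Real.exp (l * s) * g s - η * s ^ 2 / 2)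
  have hbc : ∀ g, Continuous (b g) := fun g => by
    have := g.continuous
    fun_prop
  have hb : ∀ g : ℝ →ᵇ ℝ, ∀ s, 0 ≤ s → |b g s| ≤ L * (‖g‖ + η) * Real.exp (l * s) := by
    intro g s hs
    have h1 := hFle (Real.exp (l * s) * g s - η * s ^ 2 / 2) 0
    rw [hF0, sub_zero, sub_zero] at h1
    have h2 : s ^ 2 / 2 ≤ Real.exp (l * s) := by
      have h3 := Real.quadratic_le_exp_of_nonneg hs
      have h4 : Real.exp s ≤ Real.exp (l * s) := Real.exp_le_exp.2 (by nlinarith)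
      linarith
    have h5 : |Real.exp (l * s) * g s - η * s ^ 2 / 2| ≤ (‖g‖ + η) * Real.exp (l * s) := by
      have h6 : |Real.exp (l * s) * g s| ≤ Real.exp (l * s) * ‖g‖ := by
        rw [abs_mul, Real.abs_exp]
        gcongr
        exact g.norm_coe_le_norm s
      have h7 : |η * s ^ 2 / 2| ≤ η * Real.exp (l * s) := by
        rw [abs_of_nonneg (by positivity), mul_div_assoc]
        gcongr
      calc _ ≤ |Real.exp (l * s) * g s| + |η * s ^ 2 / 2| := abs_sub _ _
        _ ≤ _ := by linarith
    calc |b g s| ≤ L * |Real.exp (l * s) * g s - η * s ^ 2 / 2| := h1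
      _ ≤ L * ((‖g‖ + η) * Real.exp (l * s)) := by gcongr
      _ = _ := by ring
  have hVc : ∀ g, Continuous fun r => ∫ u in (0 : ℝ)..r, radialMean m (b g) u := fun g =>
    intervalIntegral.continuous_primitive
      (fun _ _ => (continuous_radialMean m (hbc g)).intervalIntegrable _ _) 0
  -- Replacing r by `max r 0` freezes the map on negative r, so that it acts on bounded continuous
  -- functions on all of ℝ.
  let Tf : (ℝ →ᵇ ℝ) → ℝ → ℝ := fun g r =>
    -(Real.exp (-(l * max r 0)) * ∫ u in (0 : ℝ)..(max r 0), radialMean m (b g) u)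
  have hTc : ∀ g, Continuous (Tf g) := fun g => by
    have h1 : Continuous fun r : ℝ => max r 0 := by fun_prop
    exact ((Real.continuous_exp.comp (by fun_prop)).mul ((hVc g).comp h1)).neg
  have hTb : ∀ g r, ‖Tf g r‖ ≤ c * (L * (‖g‖ + η)) / l ^ 2 := by
    intro g r
    have h1 := abs_integral_radialMean_le m hl (by positivity) (hb g) (le_max_right r 0)
    simp only [Tf]
    rw [norm_neg, norm_mul, Real.norm_eq_abs, Real.norm_eq_abs, Real.abs_exp, Real.exp_neg,
      inv_mul_le_iff₀ (Real.exp_pos _)]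
    linarith
  let T : (ℝ →ᵇ ℝ) → (ℝ →ᵇ ℝ) := fun g =>
    BoundedContinuousFunction.ofNormedAddCommGroup (Tf g) (hTc g) _ (hTb g)
  have hT : ContractingWith (1 / 2) T := by
    refine ⟨by norm_num, LipschitzWith.of_dist_le_mul fun g₁ g₂ => ?_⟩
    rw [BoundedContinuousFunction.dist_le (by positivity)]
    intro r
    change |Tf g₁ r - Tf g₂ r| ≤ _
    have h1 : ∀ s, 0 ≤ s → |b g₁ s - b g₂ s| ≤ L * dist g₁ g₂ * Real.exp (l * s) := by
      intro s hs
      refine (hFle _ _).trans ?_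
      rw [sub_sub_sub_cancel_right, ← mul_sub, abs_mul, Real.abs_exp, mul_assoc,
        mul_comm (dist g₁ g₂)]
      gcongr
      exact BoundedContinuousFunction.dist_coe_le_dist (f := g₁) (g := g₂) s
    have h2 := abs_integral_radialMean_le m hl (by positivity) h1 (le_max_right r 0)
    have h3 : Tf g₁ r - Tf g₂ r = -(Real.exp (-(l * max r 0)) *
        ∫ u in (0 : ℝ)..(max r 0), radialMean m (fun s => b g₁ s - b g₂ s) u) := by
      simp only [Tf, ← radialMean_sub m (hbc g₁) (hbc g₂)]
      rw [intervalIntegral.integral_sub ((continuous_radialMean m (hbc g₁)).intervalIntegrable _ _)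
        ((continuous_radialMean m (hbc g₂)).intervalIntegrable _ _)]
      ring
    rw [h3, abs_neg, abs_mul, Real.abs_exp, Real.exp_neg, inv_mul_le_iff₀ (Real.exp_pos _)]
    refine h2.trans ?_
    have h4 : c * (L * dist g₁ g₂) / l ^ 2 ≤ 1 / 2 * dist g₁ g₂ := by
      rw [← mul_assoc, mul_div_right_comm]
      gcongr
    have h5 := mul_le_mul_of_nonneg_right h4 (Real.exp_pos (l * max r 0)).le
    push_cast
    linarith
  set g := ContractingWith.fixedPoint T hT with hg
  have hfix : T g = g := hT.fixedPoint_isFixedPt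
  have hfix' : ∀ r, 0 ≤ r → Real.exp (l * r) * g r = -∫ u in (0 : ℝ)..r, radialMean m (b g) u := by
    intro r hr
    have h1 : g r = Tf g r := by
      conv_lhs => rw [← hfix]
      rfl
    rw [h1]
    simp only [Tf, max_eq_left hr]
    rw [Real.exp_neg]
    field_simp
  refine ⟨fun r => Real.exp (l * r) * g r, ?_, ?_, ?_⟩
  · have := g.continuous
    fun_prop
  · simpa using hfix' 0 le_rfl
  · intro r hr
    have h1 : HasDerivAt (fun r => -∫ u in (0 : ℝ)..r, radialMean m (b g) u)
        (-(radialMean m (b g) r)) r :=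
      (intervalIntegral.integral_hasDerivAt_right
        ((continuous_radialMean m (hbc g)).intervalIntegrable _ _)
        (continuous_radialMean m (hbc g)).stronglyMeasurable.stronglyMeasurableAtFilter
        (continuous_radialMean m (hbc g)).continuousAt).neg
    rw [radialMean_eq m _ hr.ne'] at h1
    refine h1.congr_of_eventuallyEq ?_
    filter_upwards [Ioi_mem_nhds hr] with s hs
    exact hfix' s (le_of_lt hs)

/-! ### Gronwall estimates in the mass variable -/

/-- Since (`massQ`)' = s Q², the weight e^{k massQ} integrates exactly against s Q² ds and gains
1/k; this weight is bounded, unlike e^{ls}. -/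
lemma abs_integral_Q_sq_mul_le (m : ℕ) {b : ℝ → ℝ} {D k : ℝ} {a : ℕ}
    (hk : 0 < k) (hD : 0 ≤ D) {u : ℝ} (hu : 0 ≤ u)
    (h : ∀ s, 0 ≤ s → s ≤ u → |b s| ≤ D * s ^ a * Real.exp (k * massQ m s)) :
    |∫ s in (0 : ℝ)..u, s * Q m s ^ 2 * b s| ≤ D / k * u ^ a * Real.exp (k * massQ m u) := by
  have hQ := Q_continuous m
  have hM := continuous_massQ m
  have h1 : |∫ s in (0 : ℝ)..u, s * Q m s ^ 2 * b s| ≤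
      ∫ s in (0 : ℝ)..u, D * u ^ a * (Real.exp (k * massQ m s) * (s * Q m s ^ 2)) := by
    rw [← Real.norm_eq_abs]
    refine intervalIntegral.norm_integral_le_of_norm_le (g := fun s =>
      D * u ^ a * (Real.exp (k * massQ m s) * (s * Q m s ^ 2))) hu ?_
      (Continuous.intervalIntegrable (μ := volume) (by fun_prop) _ _)
    refine Eventually.of_forall fun s hs => ?_
    have hs0 : 0 ≤ s := hs.1.le
    rw [Real.norm_eq_abs, abs_mul, abs_of_nonneg (by positivity : 0 ≤ s * Q m s ^ 2)]
    have h2 : |b s| ≤ D * u ^ a * Real.exp (k * massQ m s) := by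
      refine (h s hs0 hs.2).trans ?_
      gcongr
      exact hs.2
    calc s * Q m s ^ 2 * |b s| ≤ s * Q m s ^ 2 * (D * u ^ a * Real.exp (k * massQ m s)) := by
          gcongr
      _ = _ := by ring
  have h3 : ∫ s in (0 : ℝ)..u, Real.exp (k * massQ m s) * (s * Q m s ^ 2) =
      (Real.exp (k * massQ m u) - 1) / k := by
    rw [intervalIntegral.integral_eq_sub_of_hasDerivAt
      (f := fun s => Real.exp (k * massQ m s) / k)]
    · rw [massQ_zero, mul_zero, Real.exp_zero]; ring
    · intro s _
      refine (((hasDerivAt_massQ m s).const_mul k).exp.div_const k).congr_deriv ?_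
      field_simp
    · exact Continuous.intervalIntegrable (by fun_prop) _ _
  rw [intervalIntegral.integral_const_mul, h3] at h1
  refine h1.trans ?_
  rw [show D / k * u ^ a * Real.exp (k * massQ m u) = D * u ^ a * (Real.exp (k * massQ m u) / k) by
    ring]
  gcongr
  linarith

/-- Integration of `r f' = -∫_0^r s Q² b ds` against a power bound on the right-hand side. -/
lemma abs_le_of_abs_integral_le (m : ℕ) {f b : ℝ → ℝ} (hf : Continuous f) (hf0 : f 0 = 0)
    (hd : ∀ r > 0, HasDerivAt f (-(r⁻¹ * ∫ s in (0 : ℝ)..r, s * Q m s ^ 2 * b s)) r)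
    {E r : ℝ} {a : ℕ} (ha : 1 ≤ a) (hr : 0 ≤ r) (hE : 0 ≤ E)
    (h : ∀ u, 0 < u → u ≤ r → |∫ s in (0 : ℝ)..u, s * Q m s ^ 2 * b s| ≤ E * u ^ a) :
    |f r| ≤ E * r ^ a := by
  rcases hr.eq_or_lt with rfl | hr
  · rw [hf0, abs_zero]; positivity
  obtain ⟨u, hu, hu'⟩ := exists_hasDerivAt_eq_slope f
    (fun r => -(r⁻¹ * ∫ s in (0 : ℝ)..r, s * Q m s ^ 2 * b s)) hr hf.continuousOn
    (fun s hs => hd s hs.1)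
  rw [hf0, sub_zero, sub_zero, eq_div_iff hr.ne'] at hu'
  rw [← hu', abs_mul, abs_neg, abs_mul, abs_of_pos hr, abs_of_pos (inv_pos.2 hu.1)]
  obtain ⟨a, rfl⟩ : ∃ a', a = a' + 1 := ⟨a - 1, by omega⟩
  have hu0 := hu.1
  calc u⁻¹ * |∫ s in (0 : ℝ)..u, s * Q m s ^ 2 * b s| * r ≤ u⁻¹ * (E * u ^ (a + 1)) * r := by
        gcongr; exact h u hu.1 hu.2.le
    _ = E * u ^ a * r := by rw [pow_succ]; field_simp
    _ ≤ E * r ^ a * r := by gcongr; exact hu.2.le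
    _ = _ := by ring

/-- A crude bound gaining two powers of `r`, locally uniformly. -/
lemma abs_le_pow_add_two (m : ℕ) {f b : ℝ → ℝ} (hf : Continuous f) (hf0 : f 0 = 0)
    (hd : ∀ r > 0, HasDerivAt f (-(r⁻¹ * ∫ s in (0 : ℝ)..r, s * Q m s ^ 2 * b s)) r)
    {D R : ℝ} {a : ℕ} (hD : 0 ≤ D) (hb : ∀ s, 0 ≤ s → s ≤ R → |b s| ≤ D * s ^ a)
    {r : ℝ} (hr : 0 ≤ r) (hrR : r ≤ R) :
    |f r| ≤ 8 * ((m : ℝ) + 1) ^ 2 * D * r ^ (a + 2) := by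
  refine abs_le_of_abs_integral_le m hf hf0 hd (by omega) hr (by positivity) fun u hu hur => ?_
  have h1 := intervalIntegral.norm_integral_le_of_norm_le_const (a := 0) (b := u)
    (C := 8 * ((m : ℝ) + 1) ^ 2 * D * u ^ (a + 1)) (f := fun s => s * Q m s ^ 2 * b s) ?_
  · rw [sub_zero, abs_of_pos hu] at h1
    refine h1.trans (le_of_eq ?_)
    ring
  · intro s hs
    rw [uIoc_of_le hu.le] at hs
    have hs0 : 0 ≤ s := hs.1.le
    rw [Real.norm_eq_abs, abs_mul, abs_mul, abs_of_nonneg hs0, abs_of_nonneg (sq_nonneg _)]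
    calc s * Q m s ^ 2 * |b s| ≤ u * (8 * ((m : ℝ) + 1) ^ 2) * (D * u ^ a) := by
          gcongr
          · exact hs.2
          · exact Q_sq_le m hs0
          · refine (hb s hs0 (hs.2.trans (hur.trans hrR))).trans ?_
            gcongr
            exact hs.2
      _ = _ := by ring

/-- The local bound A s^a is improved by iteration: with weight exponent 2L, each pass through the
equation halves the excess over c/L. The limit forgets A, and since the total mass is 4(m+1) the
remaining constant is uniform in r. -/
theorem abs_le_of_volterra (m : ℕ) {f b : ℝ → ℝ} (hf : Continuous f) (hf0 : f 0 = 0)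
    (hd : ∀ r > 0, HasDerivAt f (-(r⁻¹ * ∫ s in (0 : ℝ)..r, s * Q m s ^ 2 * b s)) r)
    {L c : ℝ} {a : ℕ} (hL : 0 < L) (hc : 0 ≤ c) (ha : 1 ≤ a)
    (hb : ∀ s, 0 ≤ s → |b s| ≤ L * |f s| + c * s ^ a)
    (hloc : ∀ R, 0 ≤ R → ∃ A, 0 ≤ A ∧ ∀ s, 0 ≤ s → s ≤ R → |f s| ≤ A * s ^ a)
    {r : ℝ} (hr : 0 ≤ r) :
    |f r| ≤ c / L * Real.exp (8 * L * ((m : ℝ) + 1)) * r ^ a := by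
  obtain ⟨A, hA0, hA⟩ := hloc r hr
  have key : ∀ n : ℕ, ∀ u, 0 ≤ u → u ≤ r →
      |f u| ≤ (c / L + A / 2 ^ n) * u ^ a * Real.exp (2 * L * massQ m u) := by
    intro n
    induction n with
    | zero =>
      intro u hu hur
      refine (hA u hu hur).trans ?_
      have h1 : 1 ≤ Real.exp (2 * L * massQ m u) :=
        Real.one_le_exp (by have := massQ_nonneg m u; positivity)
      have h2 : 0 ≤ c / L := by positivity
      have h3 : A * u ^ a ≤ (c / L + A / 2 ^ 0) * u ^ a := by
        gcongr; simp [h2]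
      exact h3.trans (le_mul_of_one_le_right (by positivity) h1)
    | succ n ih =>
      intro u hu hur
      have h4 := abs_le_of_abs_integral_le m hf hf0 hd ha hu
        (E := (c / L + A / 2 ^ (n + 1)) * Real.exp (2 * L * massQ m u)) (by positivity) ?_
      · refine h4.trans (le_of_eq (by ring))
      · intro v hv hvu
        -- The source is at most c + L(c/L + A/2^n) = 2c + L A/2^n times the weight; division by 2L
        -- returns c/L + A/2^(n+1).
        have h5 := abs_integral_Q_sq_mul_le m (b := b) (D := 2 * c + L * (A / 2 ^ n))
          (k := 2 * L) (a := a) (by positivity) (by positivity) hv.le ?_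
        · refine h5.trans ?_
          have h6 : massQ m v ≤ massQ m u := massQ_monotoneOn m hv.le hu hvu
          have h7 : (2 * c + L * (A / 2 ^ n)) / (2 * L) = c / L + A / 2 ^ (n + 1) := by
            field_simp
            ring
          rw [h7, mul_right_comm]
          gcongr
        · intro s hs hsv
          refine (hb s hs).trans ?_
          have h8 := ih s hs (hsv.trans (hvu.trans hur))
          have h1 : 1 ≤ Real.exp (2 * L * massQ m s) :=
            Real.one_le_exp (by have := massQ_nonneg m s; positivity)
          have h9 : c * s ^ a ≤ c * s ^ a * Real.exp (2 * L * massQ m s) :=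
            le_mul_of_one_le_right (by positivity) h1
          have h10 : L * |f s| ≤
              (c + L * (A / 2 ^ n)) * s ^ a * Real.exp (2 * L * massQ m s) := by
            refine (mul_le_mul_of_nonneg_left h8 hL.le).trans (le_of_eq ?_)
            field_simp
          linarith
  have hlim : Tendsto (fun n : ℕ => (c / L + A / 2 ^ n) * r ^ a * Real.exp (2 * L * massQ m r))
      atTop (𝓝 ((c / L + 0) * r ^ a * Real.exp (2 * L * massQ m r))) := by
    refine Tendsto.mul_const _ (Tendsto.mul_const _ (Tendsto.const_add _ ?_))
    exact tendsto_const_nhds.div_atTop (tendsto_pow_atTop_atTop_of_one_lt one_lt_two)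
  have h1 := ge_of_tendsto' hlim fun n => key n r hr le_rfl
  refine h1.trans ?_
  rw [add_zero, mul_right_comm]
  have h2 : 2 * L * massQ m r ≤ 8 * L * ((m : ℝ) + 1) := by nlinarith [massQ_le m r]
  have h3 := Real.exp_le_exp.2 h2
  gcongr

/-! ### Smoothness and quadratic bound of the exponent -/

open scoped NNReal

lemma hasDerivAt_integral_Q_sq_mul (m : ℕ) {b : ℝ → ℝ} (hb : Continuous b) (r : ℝ) :
    HasDerivAt (fun r => ∫ s in (0 : ℝ)..r, s * Q m s ^ 2 * b s) (r * Q m r ^ 2 * b r) r := by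
  have hQ := Q_continuous m
  have hc : Continuous fun s => s * Q m s ^ 2 * b s := by fun_prop
  exact intervalIntegral.integral_hasDerivAt_right (hc.intervalIntegrable _ _)
    hc.stronglyMeasurable.stronglyMeasurableAtFilter hc.continuousAt

namespace IsPerturbation

variable {m : ℕ} {F φ : ℝ → ℝ} {η : ℝ}

lemma continuous_source (h : IsPerturbation m F η φ) (hF : Continuous F) :
    Continuous fun s => F (φ s - η * s ^ 2 / 2) := by
  have := h.continuous
  fun_prop

/-- Bootstrap: if φ is C^n then so is the right-hand side of the equation for φ', and φ is C^(n+1).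
-/
lemma contDiffOn (h : IsPerturbation m F η φ) (hF : ContDiff ℝ ∞ F) :
    ContDiffOn ℝ ∞ φ (Ioi 0) := by
  rw [contDiffOn_infty]
  intro n
  induction n with
  | zero => exact contDiffOn_zero.2 h.continuous.continuousOn
  | succ n ih =>
    have hb := h.continuous_source hF.continuous
    have hG : ContDiffOn ℝ (n + 1 : ℕ)
        (fun r => ∫ s in (0 : ℝ)..r, s * Q m s ^ 2 * F (φ s - η * s ^ 2 / 2)) (Ioi 0) := by
      push_cast
      rw [contDiffOn_succ_iff_deriv_of_isOpen isOpen_Ioi]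
      refine ⟨fun r _ => (hasDerivAt_integral_Q_sq_mul m hb r).differentiableAt.differentiableWithinAt,
        by simp, ?_⟩
      rw [show deriv (fun r => ∫ s in (0 : ℝ)..r, s * Q m s ^ 2 * F (φ s - η * s ^ 2 / 2)) =
        fun r => r * Q m r ^ 2 * F (φ r - η * r ^ 2 / 2) from
        funext fun r => (hasDerivAt_integral_Q_sq_mul m hb r).deriv]
      have hQ : ContDiffOn ℝ n (Q m) (Ioi 0) :=
        ((Q_contDiff m).of_le (by exact_mod_cast le_top)).contDiffOn
      have hF' : ContDiff ℝ n F := hF.of_le (by exact_mod_cast le_top)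
      refine ContDiffOn.mul (contDiffOn_id.mul (hQ.pow 2)) ?_
      exact hF'.comp_contDiffOn (ih.sub (by fun_prop))
    push_cast
    rw [contDiffOn_succ_iff_deriv_of_isOpen isOpen_Ioi]
    refine ⟨fun r hr => (h.hasDerivAt r hr).differentiableAt.differentiableWithinAt, by simp, ?_⟩
    have h1 : ContDiffOn ℝ n (fun r : ℝ => -(r⁻¹ *
        ∫ s in (0 : ℝ)..r, s * Q m s ^ 2 * F (φ s - η * s ^ 2 / 2))) (Ioi 0) := by
      refine ((contDiffOn_id.inv fun r hr => ?_).mul (hG.of_le ?_)).neg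
      · exact (ne_of_gt hr : r ≠ 0)
      · exact_mod_cast Nat.le_succ n
    exact h1.congr fun r hr => (h.hasDerivAt r hr).deriv

lemma abs_le (h : IsPerturbation m F η φ) (hFc : Continuous F) {L : ℝ} (hL : 0 < L)
    (hF : ∀ x, |F x| ≤ L * |x|) (hη : 0 ≤ η) {r : ℝ} (hr : 0 ≤ r) :
    |φ r| ≤ Real.exp (8 * L * ((m : ℝ) + 1)) / 2 * η * r ^ 2 := by
  have h1 := abs_le_of_volterra m h.continuous h.zero h.hasDerivAt (a := 2) (c := L * η / 2) hL
    (by positivity) (by norm_num) ?_ ?_ hr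
  · refine h1.trans (le_of_eq ?_)
    field_simp
  · intro s hs
    refine (hF _).trans ?_
    have h2 : |φ s - η * s ^ 2 / 2| ≤ |φ s| + η * s ^ 2 / 2 := by
      refine (abs_sub _ _).trans ?_
      rw [abs_of_nonneg (by positivity : 0 ≤ η * s ^ 2 / 2)]
    nlinarith
  -- On [0, R] the source is bounded by compactness, and the equation turns a bounded source into a
  -- bound of order s².
  · intro R hR
    obtain ⟨D, hD⟩ := isCompact_Icc.exists_bound_of_continuousOn (s := Icc 0 R)
      (h.continuous_source hFc).continuousOn
    have hD0 : 0 ≤ D := (norm_nonneg _).trans (hD 0 ⟨le_rfl, hR⟩)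
    refine ⟨8 * ((m : ℝ) + 1) ^ 2 * D, by positivity, fun s hs hsR => ?_⟩
    exact abs_le_pow_add_two m h.continuous h.zero h.hasDerivAt (a := 0) hD0
      (fun u hu huR => by simpa using hD u ⟨hu, huR⟩) hs hsR

end IsPerturbation

/-- `∫_0^∞ r³ Q² dr`. -/
def secondMoment (m : ℕ) : ℝ := ∫ r in Ioi (0 : ℝ), r ^ 3 * Q m r ^ 2

lemma secondMoment_nonneg (m : ℕ) : 0 ≤ secondMoment m :=
  setIntegral_nonneg measurableSet_Ioi fun r hr => by
    have : (0 : ℝ) < r := hr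
    positivity

/-- Here m ≥ 1 is essential: it makes r³ Q² integrable, so a source of size s² perturbs the mass by
a bounded amount. -/
lemma abs_integral_Q_sq_mul_le_secondMoment {m : ℕ} (hm : 1 ≤ m) {b : ℝ → ℝ} {D : ℝ}
    (hb : ∀ s, 0 ≤ s → |b s| ≤ D * s ^ 2) (hD : 0 ≤ D) {r : ℝ} (hr : 0 ≤ r) :
    |∫ s in (0 : ℝ)..r, s * Q m s ^ 2 * b s| ≤ D * secondMoment m := by
  have hQ := Q_continuous m
  have h1 : |∫ s in (0 : ℝ)..r, s * Q m s ^ 2 * b s| ≤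
      ∫ s in (0 : ℝ)..r, D * (s ^ 3 * Q m s ^ 2) := by
    rw [← Real.norm_eq_abs]
    refine intervalIntegral.norm_integral_le_of_norm_le hr ?_
      (Continuous.intervalIntegrable (by fun_prop) _ _)
    refine Eventually.of_forall fun s hs => ?_
    have hs0 : 0 ≤ s := hs.1.le
    rw [Real.norm_eq_abs, abs_mul, abs_of_nonneg (by positivity : 0 ≤ s * Q m s ^ 2)]
    calc s * Q m s ^ 2 * |b s| ≤ s * Q m s ^ 2 * (D * s ^ 2) := by gcongr; exact hb s hs0
      _ = _ := by ring
  refine h1.trans ?_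
  rw [intervalIntegral.integral_const_mul, intervalIntegral.integral_of_le hr]
  refine mul_le_mul_of_nonneg_left ?_ hD
  refine setIntegral_mono_set (integrableOn_pow_mul_Q_sq m 3 (by omega)) ?_
    (Ioc_subset_Ioi_self.eventuallyLE)
  refine (ae_restrict_mem measurableSet_Ioi).mono fun s hs => ?_
  have : (0 : ℝ) < s := hs
  simp only [Pi.zero_apply]
  positivity

lemma exp_sub_exp_abs_le {x y : ℝ} (hx : x ≤ 1) (hy : y ≤ 1) :
    |Real.exp x - Real.exp y| ≤ 3 * |x - y| := by
  wlog h : y ≤ x generalizing x y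
  · rw [abs_sub_comm, abs_sub_comm x]
    exact this hy hx (le_of_not_ge h)
  rw [abs_of_nonneg (sub_nonneg.2 (Real.exp_le_exp.2 h)), abs_of_nonneg (sub_nonneg.2 h)]
  have h1 : Real.exp y = Real.exp x * Real.exp (y - x) := by rw [← Real.exp_add]; ring_nf
  have h2 := Real.add_one_le_exp (y - x)
  have h3 : Real.exp x ≤ 3 := by
    have := Real.exp_le_exp.2 hx
    have := Real.exp_one_lt_d9
    linarith
  have h4 := Real.exp_pos x
  nlinarith

/-- The cutoff makes the exponential nonlinearity globally Lipschitz; `exists_profile` shows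
afterwards that it is inactive. -/
lemma lipschitzWith_truncatedExp : LipschitzWith 3 fun x : ℝ => Real.exp (min x 1) - 1 := by
  refine LipschitzWith.of_dist_le_mul fun x y => ?_
  rw [Real.dist_eq, Real.dist_eq, sub_sub_sub_cancel_right]
  refine (exp_sub_exp_abs_le (min_le_right _ _) (min_le_right _ _)).trans ?_
  have := abs_min_sub_min_le_max x 1 y 1
  simp only [sub_self, abs_zero, max_eq_left (abs_nonneg (x - y))] at this
  push_cast
  linarith

/-- A function growing at most like `η log r` stays below `1 + η r²/4` if `η` is small. -/
lemma le_one_add_of_deriv_le {f f' : ℝ → ℝ} {η C K : ℝ} (hf : Continuous f) (hη : 0 ≤ η)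
    (hC : 0 ≤ C) (hd : ∀ r > 0, HasDerivAt f (f' r) r) (hf' : ∀ r > 0, f' r ≤ K * η / r)
    (hK : 0 ≤ K) (hfC : ∀ r, 0 ≤ r → f r ≤ C * η * r ^ 2) (hsmall : C * (2 * K) * η ≤ 1)
    {r : ℝ} (hr : 0 ≤ r) : f r ≤ 1 + η * r ^ 2 / 4 := by
  have hsmallr : ∀ r, 0 ≤ r → r ^ 2 ≤ 2 * K → f r ≤ 1 + η * r ^ 2 / 4 := by
    intro r hr h
    have h1 := hfC r hr
    have h2 : C * η * r ^ 2 ≤ C * η * (2 * K) := by gcongr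
    have h3 : 0 ≤ η * r ^ 2 / 4 := by positivity
    linarith
  rcases le_total (r ^ 2) (2 * K) with h | h
  · exact hsmallr r hr h
  have hsq := Real.sq_sqrt (by positivity : 0 ≤ 2 * K)
  have hs0 := Real.sqrt_nonneg (2 * K)
  -- Beyond r² = 2K the slope Kη/r is at most ηr/2, the slope of η r²/4; up to that radius the
  -- quadratic bound and the smallness of η suffice.
  have hanti : AntitoneOn (fun r => f r - η * r ^ 2 / 4) (Ici √(2 * K)) := by
    refine antitoneOn_of_hasDerivWithinAt_nonpos (f' := fun r => f' r - η * r / 2) (convex_Ici _)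
      (by fun_prop) ?_ ?_
    · intro r hr
      rw [interior_Ici] at hr
      have hr0 : 0 < r := lt_of_le_of_lt hs0 hr
      have h4 : HasDerivAt (fun r : ℝ => η * r ^ 2 / 4) (η * r / 2) r := by
        refine (((hasDerivAt_pow 2 r).const_mul η).div_const 4).congr_deriv ?_
        push_cast; ring
      exact ((hd r hr0).sub h4).hasDerivWithinAt
    · intro r hr
      rw [interior_Ici] at hr
      have hr0 : 0 < r := lt_of_le_of_lt hs0 hr
      have hr' : √(2 * K) < r := hr
      have h5 : 2 * K ≤ r ^ 2 := by rw [← hsq]; gcongr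
      have h6 : K * η / r ≤ η * r / 2 := by
        rw [div_le_iff₀ hr0]
        nlinarith
      linarith [hf' r hr0]
  have hle : √(2 * K) ≤ r := by
    rw [Real.sqrt_le_left hr]; exact h
  have h7 := hanti (mem_Ici.2 le_rfl) hle hle
  have h8 := hsmallr _ hs0 hsq.le
  simp only at h7
  linarith

lemma abs_exp_sub_one_le {x : ℝ} (hx : x ≤ 1) : |Real.exp x - 1| ≤ 3 * |x| := by
  simpa using exp_sub_exp_abs_le hx zero_le_one

/-- Existence of the deformed profile, together with the a priori bounds on the exponent. -/
theorem exists_profile {m : ℕ} (hm : 1 ≤ m) : ∃ C η₀ : ℝ, 0 < C ∧ 0 < η₀ ∧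
    ∀ η, 0 ≤ η → η ≤ η₀ → ∃ φ, IsPerturbation m (fun x => Real.exp x - 1) η φ ∧
      (∀ r, 0 ≤ r → |φ r| ≤ C * η * r ^ 2) ∧
      (∀ r, 0 ≤ r → |φ r| ≤ 1 + η * r ^ 2 / 4) ∧
      ∀ r, 0 ≤ r →
        |∫ s in (0 : ℝ)..r, s * Q m s ^ 2 * (Real.exp (φ s - η * s ^ 2 / 2) - 1)| ≤ C * η := by
  set C₁ : ℝ := Real.exp (8 * 3 * ((m : ℝ) + 1)) / 2 with hC₁
  have hC₁0 : 0 < C₁ := by positivity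
  set K : ℝ := 3 * (C₁ + 1 / 2) * secondMoment m with hK
  have hK0 : 0 ≤ K := by have := secondMoment_nonneg m; positivity
  refine ⟨C₁ + K, 1 / (C₁ * (2 * K) + 1), by positivity, by positivity, fun η hη hη₀ => ?_⟩
  have hsmall : C₁ * (2 * K) * η ≤ 1 := by
    rw [le_div_iff₀ (by positivity)] at hη₀
    nlinarith
  obtain ⟨φ, hφ⟩ := exists_isPerturbation m lipschitzWith_truncatedExp (by simp) hη
  have hFc := lipschitzWith_truncatedExp.continuous
  have hF : ∀ x : ℝ, |Real.exp (min x 1) - 1| ≤ 3 * |x| := fun x => by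
    simpa [Real.dist_eq] using lipschitzWith_truncatedExp.dist_le_mul x 0
  have h1 : ∀ r, 0 ≤ r → |φ r| ≤ C₁ * η * r ^ 2 := fun r hr =>
    hφ.abs_le hFc (by norm_num) hF hη hr
  have h2 : ∀ r, 0 ≤ r → |∫ s in (0 : ℝ)..r, s * Q m s ^ 2 *
      (Real.exp (min (φ s - η * s ^ 2 / 2) 1) - 1)| ≤ K * η := by
    intro r hr
    have h3 := abs_integral_Q_sq_mul_le_secondMoment hm
      (b := fun s => Real.exp (min (φ s - η * s ^ 2 / 2) 1) - 1) (D := 3 * (C₁ + 1 / 2) * η)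
      ?_ (by positivity) hr
    · refine h3.trans (le_of_eq ?_)
      rw [hK]; ring
    · intro s hs
      refine (hF _).trans ?_
      have h4 : |φ s - η * s ^ 2 / 2| ≤ |φ s| + η * s ^ 2 / 2 := by
        refine (abs_sub _ _).trans ?_
        rw [abs_of_nonneg (by positivity : 0 ≤ η * s ^ 2 / 2)]
      have h5 := h1 s hs
      nlinarith
  have hderiv : ∀ r > 0, |-(r⁻¹ * ∫ s in (0 : ℝ)..r, s * Q m s ^ 2 *
      (Real.exp (min (φ s - η * s ^ 2 / 2) 1) - 1))| ≤ K * η / r := by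
    intro r hr
    rw [abs_neg, abs_mul, abs_of_pos (inv_pos.2 hr), inv_mul_eq_div]
    gcongr
    exact h2 r hr.le
  have h6 : ∀ r, 0 ≤ r → |φ r| ≤ 1 + η * r ^ 2 / 4 := by
    intro r hr
    rw [abs_le']
    constructor
    · exact le_one_add_of_deriv_le hφ.continuous hη hC₁0.le hφ.hasDerivAt
        (fun r hr => (le_abs_self _).trans (hderiv r hr)) hK0
        (fun r hr => (le_abs_self _).trans (h1 r hr)) hsmall hr
    · exact le_one_add_of_deriv_le hφ.continuous.neg hη hC₁0.le
        (fun r hr => (hφ.hasDerivAt r hr).neg)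
        (fun r hr => (neg_le_abs _).trans (hderiv r hr)) hK0
        (fun r hr => (neg_le_abs _).trans (h1 r hr)) hsmall hr
  -- The bound just obtained gives φ - η s²/2 ≤ 1 - η s²/4 ≤ 1, so the cutoff disappears.
  have h7 : ∀ r, 0 ≤ r → ∫ s in (0 : ℝ)..r, s * Q m s ^ 2 *
      (Real.exp (min (φ s - η * s ^ 2 / 2) 1) - 1) =
      ∫ s in (0 : ℝ)..r, s * Q m s ^ 2 * (Real.exp (φ s - η * s ^ 2 / 2) - 1) := by
    intro r hr
    refine intervalIntegral.integral_congr fun s hs => ?_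
    rw [uIcc_of_le hr] at hs
    have h8 : φ s - η * s ^ 2 / 2 ≤ 1 := by
      have := (le_abs_self _).trans (h6 s hs.1)
      have : 0 ≤ η * s ^ 2 := by positivity
      linarith
    simp only [min_eq_left h8]
  refine ⟨φ, ⟨hφ.continuous, hφ.zero, fun r hr => ?_⟩, fun r hr => ?_, h6, fun r hr => ?_⟩
  · have := hφ.hasDerivAt r hr
    rwa [h7 r (le_of_lt hr)] at this
  · refine (h1 r hr).trans ?_
    gcongr
    linarith
  · rw [← h7 r hr]
    refine (h2 r hr).trans ?_
    gcongr
    linarith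

/-- Existence of the first variation of the exponent. -/
theorem exists_firstVariation (m : ℕ) : ∃ φ C, 0 < C ∧ IsPerturbation m (fun x => x) 1 φ ∧
    ∀ r, 0 ≤ r → |φ r| ≤ C * r ^ 2 := by
  obtain ⟨φ, hφ⟩ := exists_isPerturbation m (F := fun x => x) LipschitzWith.id rfl zero_le_one
  refine ⟨φ, Real.exp (8 * 1 * ((m : ℝ) + 1)) / 2 * 1, by positivity, hφ, fun r hr => ?_⟩
  exact hφ.abs_le continuous_id one_pos (by simp) zero_le_one hr

lemma abs_exp_sub_one_sub_self_le {x : ℝ} (hx : x ≤ 1) : |Real.exp x - 1 - x| ≤ x ^ 2 := by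
  rcases le_total (-1) x with h | h
  · exact Real.abs_exp_sub_one_sub_id_le (abs_le.2 ⟨h, hx⟩)
  · rw [abs_of_nonneg (by linarith [Real.add_one_le_exp x])]
    have : Real.exp x ≤ 1 := Real.exp_le_one_iff.2 (by linarith)
    nlinarith

/-- The exponent is differentiable in `η`, with a quadratic remainder. -/
theorem exists_abs_sub_firstVariation_le (m : ℕ) {φ₁ : ℝ → ℝ} {C C₁ : ℝ} (hC : 0 < C)
    (hC₁ : 0 < C₁)
    (h₁ : IsPerturbation m (fun x => x) 1 φ₁) (hb₁ : ∀ r, 0 ≤ r → |φ₁ r| ≤ C₁ * r ^ 2) :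
    ∃ D, 0 < D ∧ ∀ η φ, 0 ≤ η → IsPerturbation m (fun x => Real.exp x - 1) η φ →
      (∀ r, 0 ≤ r → |φ r| ≤ C * η * r ^ 2) → (∀ r, 0 ≤ r → |φ r| ≤ 1 + η * r ^ 2 / 4) →
      ∀ r, 0 ≤ r → |φ r - η * φ₁ r| ≤ D * (η ^ 2 * r ^ 4) := by
  have hQ := Q_continuous m
  refine ⟨(C + 1 / 2) ^ 2 * Real.exp (8 * 1 * ((m : ℝ) + 1)), by positivity,
    fun η φ hη h hb hb' r hr => ?_⟩
  have hcont : Continuous fun s => φ s - η * φ₁ s := h.continuous.sub (h₁.continuous.const_mul η)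
  have hzero : φ 0 - η * φ₁ 0 = 0 := by rw [h.zero, h₁.zero]; ring
  have hs₀ := h.continuous_source (F := fun x => Real.exp x - 1) (by fun_prop)
  have hs₁ := h₁.continuous_source (F := fun x => x) continuous_id
  have hder : ∀ r > 0, HasDerivAt (fun s => φ s - η * φ₁ s) (-(r⁻¹ * ∫ s in (0 : ℝ)..r,
      s * Q m s ^ 2 * ((Real.exp (φ s - η * s ^ 2 / 2) - 1) - η * (φ₁ s - 1 * s ^ 2 / 2)))) r := by
    intro r hr
    refine ((h.hasDerivAt r hr).sub ((h₁.hasDerivAt r hr).const_mul η)).congr_deriv ?_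
    have : ∫ s in (0 : ℝ)..r, s * Q m s ^ 2 *
        ((Real.exp (φ s - η * s ^ 2 / 2) - 1) - η * (φ₁ s - 1 * s ^ 2 / 2)) =
        (∫ s in (0 : ℝ)..r, s * Q m s ^ 2 * (Real.exp (φ s - η * s ^ 2 / 2) - 1)) -
        η * ∫ s in (0 : ℝ)..r, s * Q m s ^ 2 * (φ₁ s - 1 * s ^ 2 / 2) := by
      rw [← intervalIntegral.integral_const_mul, ← intervalIntegral.integral_sub]
      · refine intervalIntegral.integral_congr fun s _ => ?_
        ring
      · exact Continuous.intervalIntegrable (by fun_prop) _ _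
      · exact Continuous.intervalIntegrable (by fun_prop) _ _
    rw [this]
    ring
  have hsrc : ∀ s, 0 ≤ s →
      |(Real.exp (φ s - η * s ^ 2 / 2) - 1) - η * (φ₁ s - 1 * s ^ 2 / 2)| ≤
      1 * |φ s - η * φ₁ s| + (C + 1 / 2) ^ 2 * η ^ 2 * s ^ 4 := by
    intro s hs
    have hp : 0 ≤ η * s ^ 2 := by positivity
    have h1 : φ s - η * s ^ 2 / 2 ≤ 1 := by
      have := (le_abs_self _).trans (hb' s hs)
      linarith
    have h2 := abs_exp_sub_one_sub_self_le h1
    have h3 : |φ s - η * s ^ 2 / 2| ≤ (C + 1 / 2) * (η * s ^ 2) := by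
      refine (abs_sub _ _).trans ?_
      rw [abs_of_nonneg (by positivity : 0 ≤ η * s ^ 2 / 2)]
      linarith [hb s hs]
    have h4 : (φ s - η * s ^ 2 / 2) ^ 2 ≤ (C + 1 / 2) ^ 2 * η ^ 2 * s ^ 4 := by
      rw [← sq_abs]
      calc _ ≤ ((C + 1 / 2) * (η * s ^ 2)) ^ 2 := by gcongr
        _ = _ := by ring
    calc _ = |(φ s - η * φ₁ s) + (Real.exp (φ s - η * s ^ 2 / 2) - 1 - (φ s - η * s ^ 2 / 2))| := by
          congr 1; ring
      _ ≤ |φ s - η * φ₁ s| + |Real.exp (φ s - η * s ^ 2 / 2) - 1 - (φ s - η * s ^ 2 / 2)| :=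
          abs_add_le _ _
      _ ≤ _ := by linarith
  have hquad : ∀ s, 0 ≤ s → |φ s - η * φ₁ s| ≤ (C * η + η * C₁) * s ^ 2 := by
    intro s hs
    refine (abs_sub _ _).trans ?_
    rw [abs_mul, abs_of_nonneg hη]
    have := mul_le_mul_of_nonneg_left (hb₁ s hs) hη
    linarith [hb s hs]
  -- The difference solves the same Volterra equation with a source of order η² s⁴. The a priori
  -- quartic bound it needs comes from the quadratic bounds on φ and φ₁, since the equation gains
  -- two powers.
  have key := abs_le_of_volterra m hcont hzero hder (a := 4) one_pos
    (by positivity : 0 ≤ (C + 1 / 2) ^ 2 * η ^ 2) (by norm_num) hsrc ?_ hr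
  · refine key.trans (le_of_eq ?_)
    ring
  · intro R hR
    refine ⟨8 * ((m : ℝ) + 1) ^ 2 * ((C * η + η * C₁) + (C + 1 / 2) ^ 2 * η ^ 2 * R ^ 2),
      by positivity, fun s hs hsR => ?_⟩
    refine abs_le_pow_add_two m hcont hzero hder (a := 2) (R := R) (by positivity)
      (fun u hu huR => (hsrc u hu).trans ?_) hs hsR
    have h5 := hquad u hu
    have h6 : (C + 1 / 2) ^ 2 * η ^ 2 * u ^ 4 ≤ (C + 1 / 2) ^ 2 * η ^ 2 * R ^ 2 * u ^ 2 := by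
      calc _ = (C + 1 / 2) ^ 2 * η ^ 2 * u ^ 2 * u ^ 2 := by ring
        _ ≤ _ := by gcongr
    linarith

/-! ### The generalized mode ρ -/

lemma Atheta_Q (m : ℕ) (r : ℝ) : Atheta (Q m) r = -(massQ m r / 2) := by
  unfold Atheta
  rw [show (fun s => |Q m s| ^ 2 * s) = fun s => s * Q m s ^ 2 by
    funext s; rw [sq_abs, mul_comm], integral_Q_sq]
  ring

lemma integral_Ioi_Q_sq (m : ℕ) {r : ℝ} (hr : 0 ≤ r) :
    ∫ s in Ioi r, s * Q m s ^ 2 = 4 * ((m : ℝ) + 1) - massQ m r := by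
  refine integral_Ioi_of_hasDerivAt_of_tendsto' (fun s _ => hasDerivAt_massQ m s) ?_
    (tendsto_massQ m)
  have := integrableOn_pow_mul_Q_sq m 1 (by omega)
  simp only [pow_one] at this
  exact this.mono_set (Ioi_subset_Ioi hr)

/-- The generalized mode attached to the first variation `φ₁` of the exponent. -/
def modeOf (m : ℕ) (φ₁ : ℝ → ℝ) (r : ℝ) : ℝ :=
  -(Q m r * (φ₁ r - 1 * r ^ 2 / 2)) / (2 * ((m : ℝ) + 1))

/-- As D_+^{(Q)} Q = 0, L_Q(Qw) = Q (w' + r⁻¹ ∫_0^r s Q² w ds). For w proportional to φ₁ - r²/2, the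
equation of φ₁ cancels the integral and leaves the derivative of r²/2. -/
lemma Lop_modeOf {m : ℕ} {φ₁ : ℝ → ℝ} (h : IsPerturbation m (fun x => x) 1 φ₁) {r : ℝ}
    (hr : 0 < r) : Lop m (Q m) (modeOf m φ₁) r = 1 / (2 * ((m : ℝ) + 1)) * (r * Q m r) := by
  have h1 : HasDerivAt (fun r : ℝ => 1 * r ^ 2 / 2) r r := by
    refine (((hasDerivAt_pow 2 r).const_mul 1).div_const 2).congr_deriv ?_
    push_cast; ring
  have h2 : HasDerivAt (modeOf m φ₁) _ r :=
    (((hasDerivAt_Q m hr).mul ((h.hasDerivAt r hr).sub h1)).neg).div_const (2 * ((m : ℝ) + 1))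
  have h3 : ∫ s in (0 : ℝ)..r, Q m s * modeOf m φ₁ s * s = -(1 / (2 * ((m : ℝ) + 1))) *
      ∫ s in (0 : ℝ)..r, s * Q m s ^ 2 * (φ₁ s - 1 * s ^ 2 / 2) := by
    rw [← intervalIntegral.integral_const_mul]
    refine intervalIntegral.integral_congr fun s _ => ?_
    simp only [modeOf]
    ring
  rw [Lop, Dplus, Bop, h2.deriv, h3, Atheta_Q]
  simp only [modeOf, Pi.sub_apply]
  field_simp
  ring

theorem isGeneralizedMode_modeOf {m : ℕ} {φ₁ : ℝ → ℝ} {C : ℝ}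
    (h : IsPerturbation m (fun x => x) 1 φ₁) (hC : ∀ r, 0 ≤ r → |φ₁ r| ≤ C * r ^ 2) :
    IsGeneralizedMode m (modeOf m φ₁) where
  smooth := by
    unfold modeOf
    have h1 := h.contDiffOn contDiff_id
    have h2 := (Q_contDiff m).contDiffOn (s := Ioi 0)
    exact ((h2.mul (h1.sub (by fun_prop))).neg).div_const _
  first_order r hr := Lop_modeOf h hr
  eqn r hr := by
    have hn : (0 : ℝ) < (m : ℝ) + 1 := by positivity
    have h1 : HasDerivAt (fun r => 1 / (2 * ((m : ℝ) + 1)) * (r * Q m r))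
        (1 / (2 * ((m : ℝ) + 1)) * (1 * Q m r + r * (((m : ℝ) - massQ m r / 2) / r * Q m r))) r :=
      ((hasDerivAt_id r).mul (hasDerivAt_Q m hr)).const_mul _
    have h2 : Lop m (Q m) (modeOf m φ₁) =ᶠ[𝓝 r] fun r => 1 / (2 * ((m : ℝ) + 1)) * (r * Q m r) := by
      filter_upwards [Ioi_mem_nhds hr] with s hs using Lop_modeOf h hs
    have h3 : ∫ s in Ioi r, Q m s * Lop m (Q m) (modeOf m φ₁) s =
        1 / (2 * ((m : ℝ) + 1)) * (4 * ((m : ℝ) + 1) - massQ m r) := by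
      rw [← integral_Ioi_Q_sq m (le_of_lt hr), ← integral_const_mul]
      refine setIntegral_congr_fun measurableSet_Ioi fun s hs => ?_
      rw [Lop_modeOf h ((show (0 : ℝ) < r from hr).trans hs)]
      ring
    have hr0 : r ≠ 0 := ne_of_gt hr
    rw [LopAdj, DplusAdj, BopAdj, h2.deriv_eq, h1.deriv, h3, Lop_modeOf h hr, Atheta_Q]
    field_simp
    ring
  bound := by
    refine ⟨(C + 1 / 2) / (2 * ((m : ℝ) + 1)), fun r hr => ?_⟩
    have hr0 : 0 < r := hr
    have hQ := Q_pos m hr0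
    have h1 : |φ₁ r - 1 * r ^ 2 / 2| ≤ (C + 1 / 2) * r ^ 2 := by
      refine (abs_sub _ _).trans ?_
      rw [abs_of_nonneg (by positivity : 0 ≤ 1 * r ^ 2 / 2)]
      linarith [hC r hr0.le]
    rw [modeOf, abs_div, abs_neg, abs_mul, abs_of_pos hQ,
      abs_of_pos (by positivity : 0 < 2 * ((m : ℝ) + 1)), div_mul_eq_mul_div]
    refine div_le_div_of_nonneg_right ?_ (by positivity)
    calc Q m r * |φ₁ r - 1 * r ^ 2 / 2| ≤ Q m r * ((C + 1 / 2) * r ^ 2) := by gcongr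
      _ = _ := by ring

/-- The exponent `φ` of a deformed profile, with the bounds that hold uniformly in small `η`. -/
structure IsProfile (m : ℕ) (C η : ℝ) (φ : ℝ → ℝ) : Prop
    extends IsPerturbation m (fun x => Real.exp x - 1) η φ where
  nonneg : 0 ≤ η
  C_pos : 0 < C
  small : C * η ≤ 1
  small' : 4 * ((m : ℝ) + 1) * η ≤ 1
  quad_bound : ∀ r, 0 ≤ r → |φ r| ≤ C * η * r ^ 2
  bound : ∀ r, 0 ≤ r → |φ r| ≤ 1 + η * r ^ 2 / 4
  mass_bound : ∀ r, 0 ≤ r →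
    |∫ s in (0 : ℝ)..r, s * Q m s ^ 2 * (Real.exp (φ s - η * s ^ 2 / 2) - 1)| ≤ C * η

/-- The profile `P` with exponent `φ`. -/
def profP (m : ℕ) (φ : ℝ → ℝ) (r : ℝ) : ℝ := Q m r * Real.exp (φ r / 2)

/-- The deformed profile `e^{-η r²/4} P` with exponent `φ`. -/
def profQ (m : ℕ) (η : ℝ) (φ : ℝ → ℝ) (r : ℝ) : ℝ :=
  Q m r * Real.exp ((φ r - η * r ^ 2 / 2) / 2)

/-- The logarithmic derivative `m + A_θ` of `P`. -/
def angular (m : ℕ) (η : ℝ) (φ : ℝ → ℝ) (r : ℝ) : ℝ := (m : ℝ) + Atheta (profQ m η φ) r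

/-! ### The deformed profiles: equations and pointwise bounds -/

lemma profQ_eq (m : ℕ) (η : ℝ) (φ : ℝ → ℝ) (r : ℝ) :
    profQ m η φ r = Real.exp (-(η * r ^ 2 / 4)) * profP m φ r := by
  rw [profQ, profP, mul_left_comm, ← Real.exp_add]
  ring_nf

lemma profQ_sq (m : ℕ) (η : ℝ) (φ : ℝ → ℝ) (r : ℝ) :
    profQ m η φ r ^ 2 = Q m r ^ 2 * Real.exp (φ r - η * r ^ 2 / 2) := by
  rw [profQ, mul_pow, ← Real.exp_nat_mul]
  congr 2
  push_cast; ring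

lemma profP_pos (m : ℕ) (φ : ℝ → ℝ) {r : ℝ} (hr : 0 < r) : 0 < profP m φ r :=
  mul_pos (Q_pos m hr) (Real.exp_pos _)

lemma profQ_pos (m : ℕ) (η : ℝ) (φ : ℝ → ℝ) {r : ℝ} (hr : 0 < r) : 0 < profQ m η φ r :=
  mul_pos (Q_pos m hr) (Real.exp_pos _)

lemma exp_one_lt_three : Real.exp 1 < 3 := by
  have := Real.exp_one_lt_d9
  linarith

namespace IsProfile

variable {m : ℕ} {C η : ℝ} {φ : ℝ → ℝ}

lemma continuous_profQ (h : IsProfile m C η φ) : Continuous (profQ m η φ) := by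
  have h1 := h.continuous
  have h2 := Q_continuous m
  unfold profQ
  fun_prop

lemma contDiffOn_profP (h : IsProfile m C η φ) : ContDiffOn ℝ ∞ (profP m φ) (Ioi 0) := by
  have h1 := h.toIsPerturbation.contDiffOn (Real.contDiff_exp.sub contDiff_const)
  exact (Q_contDiff m).contDiffOn.mul (Real.contDiff_exp.comp_contDiffOn (h1.div_const 2))

lemma contDiffOn_profQ (h : IsProfile m C η φ) : ContDiffOn ℝ ∞ (profQ m η φ) (Ioi 0) := by
  have h1 := h.toIsPerturbation.contDiffOn (Real.contDiff_exp.sub contDiff_const)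
  exact (Q_contDiff m).contDiffOn.mul
    (Real.contDiff_exp.comp_contDiffOn ((h1.sub (by fun_prop)).div_const 2))

lemma integral_profQ_sq (h : IsProfile m C η φ) (r : ℝ) :
    ∫ s in (0 : ℝ)..r, |profQ m η φ s| ^ 2 * s = massQ m r +
      ∫ s in (0 : ℝ)..r, s * Q m s ^ 2 * (Real.exp (φ s - η * s ^ 2 / 2) - 1) := by
  have h1 := h.continuous
  have h2 := Q_continuous m
  rw [← integral_Q_sq, ← intervalIntegral.integral_add]
  · refine intervalIntegral.integral_congr fun s _ => ?_
    simp only [sq_abs, profQ_sq]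
    ring
  · exact Continuous.intervalIntegrable (by fun_prop) _ _
  · exact Continuous.intervalIntegrable (by fun_prop) _ _

lemma angular_eq (h : IsProfile m C η φ) (r : ℝ) :
    angular m η φ r = (m : ℝ) - massQ m r / 2 -
      (∫ s in (0 : ℝ)..r, s * Q m s ^ 2 * (Real.exp (φ s - η * s ^ 2 / 2) - 1)) / 2 := by
  rw [angular, Atheta, h.integral_profQ_sq]
  ring

lemma hasDerivAt_profP (h : IsProfile m C η φ) {r : ℝ} (hr : 0 < r) :
    HasDerivAt (profP m φ) (angular m η φ r / r * profP m φ r) r := by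
  have h1 := (hasDerivAt_Q m hr).mul ((h.hasDerivAt r hr).div_const 2).exp
  refine h1.congr_deriv ?_
  rw [h.angular_eq, profP]
  generalize (∫ s in (0 : ℝ)..r, s * Q m s ^ 2 * (Real.exp (φ s - η * s ^ 2 / 2) - 1)) = G
  field_simp
  ring

lemma hasDerivAt_profQ (h : IsProfile m C η φ) {r : ℝ} (hr : 0 < r) :
    HasDerivAt (profQ m η φ) ((angular m η φ r / r - η * r / 2) * profQ m η φ r) r := by
  have h0 : HasDerivAt (fun r : ℝ => -(η * r ^ 2 / 4)) (-(η * r / 2)) r := by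
    refine (((hasDerivAt_pow 2 r).const_mul η).div_const 4).neg.congr_deriv ?_
    push_cast; ring
  have h1 := h0.exp.mul (h.hasDerivAt_profP hr)
  rw [show profQ m η φ = fun r => Real.exp (-(η * r ^ 2 / 4)) * profP m φ r from
    funext (profQ_eq m η φ)]
  refine h1.congr_deriv ?_
  ring

lemma Dplus_eq_zero (h : IsProfile m C η φ) {r : ℝ} (hr : 0 < r) :
    Dplus m (profQ m η φ) (profP m φ) r = 0 := by
  rw [Dplus, (h.hasDerivAt_profP hr).deriv, angular]
  ring

/-- In this range m - `massQ`/2 ≤ -(m+1) ≤ -2, and Cη ≤ 1 lets the perturbation of the mass cost at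
most 1/2. The point is to stay strictly below -1. -/
lemma angular_le (h : IsProfile m C η φ) (hm : 1 ≤ m) {r : ℝ} (hr : 0 ≤ r)
    (hx : 2 * ((m : ℝ) + 1) ≤ r ^ (2 * (m + 1))) : angular m η φ r ≤ -3 / 2 := by
  have hm' : (1 : ℝ) ≤ m := by exact_mod_cast hm
  rw [h.angular_eq, massQ_eq]
  have h1 := (abs_le.1 ((h.mass_bound r hr).trans h.small)).1
  have h2 : 4 * ((m : ℝ) + 1) / (1 + r ^ (2 * (m + 1))) ≤ 2 := by
    rw [div_le_iff₀ (one_add_pow_pos m r)]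
    linarith
  linarith

lemma abs_angular_le (h : IsProfile m C η φ) {r : ℝ} (hr : 0 ≤ r) :
    |angular m η φ r| ≤ 3 * ((m : ℝ) + 1) := by
  have hm' : (0 : ℝ) ≤ m := by positivity
  have h1 := abs_le.1 ((h.mass_bound r hr).trans h.small)
  have h2 := massQ_nonneg m r
  have h3 := massQ_le m r
  rw [h.angular_eq, abs_le]
  constructor <;> linarith [h1.1, h1.2]

/-- The growth allowed to φ uses up only half of the Gaussian, so e^{-η r²/8} survives. -/
lemma exponent_le (h : IsProfile m C η φ) {r : ℝ} (hr : 0 ≤ r) :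
    (φ r - η * r ^ 2 / 2) / 2 ≤ 1 + -(η * r ^ 2 / 8) := by
  have h1 := (le_abs_self _).trans (h.bound r hr)
  linarith

lemma exponent_le_one (h : IsProfile m C η φ) {r : ℝ} (hr : 0 ≤ r) :
    (φ r - η * r ^ 2 / 2) / 2 ≤ 1 := by
  have h1 := h.exponent_le hr
  have h2 : 0 ≤ η * r ^ 2 := mul_nonneg h.nonneg (sq_nonneg r)
  linarith

lemma abs_exponent_le (h : IsProfile m C η φ) {r : ℝ} (hr : 0 ≤ r) :
    |(φ r - η * r ^ 2 / 2) / 2| ≤ (C + 1) * η * r ^ 2 := by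
  have h1 := abs_le.1 (h.quad_bound r hr)
  have h2 : 0 ≤ η * r ^ 2 := mul_nonneg h.nonneg (sq_nonneg r)
  have h3 : 0 ≤ C * (η * r ^ 2) := mul_nonneg h.C_pos.le h2
  rw [abs_le]
  constructor <;> linarith [h1.1, h1.2]

lemma profQ_le_exp (h : IsProfile m C η φ) {r : ℝ} (hr : 0 ≤ r) :
    profQ m η φ r ≤ 3 * Real.exp (-(η * r ^ 2 / 8)) * Q m r := by
  rw [profQ, mul_comm]
  have h1 := Real.exp_le_exp.2 (h.exponent_le hr)
  rw [Real.exp_add] at h1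
  have h2 := exp_one_lt_three
  have h3 := Q_nonneg m hr
  gcongr
  refine h1.trans ?_
  gcongr

lemma profQ_le (h : IsProfile m C η φ) {r : ℝ} (hr : 0 ≤ r) : profQ m η φ r ≤ 3 * Q m r := by
  refine (h.profQ_le_exp hr).trans ?_
  have h1 : Real.exp (-(η * r ^ 2 / 8)) ≤ 1 := by
    rw [Real.exp_le_one_iff]
    have h2 : 0 ≤ η * r ^ 2 := mul_nonneg h.nonneg (sq_nonneg r)
    linarith
  have h3 := Q_nonneg m hr
  nlinarith

lemma profQ_sq_le (h : IsProfile m C η φ) {r : ℝ} (hr : 0 ≤ r) :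
    profQ m η φ r ^ 2 ≤ 9 * Q m r ^ 2 := by
  have h1 := h.profQ_le hr
  have h2 : 0 ≤ profQ m η φ r := mul_nonneg (Q_nonneg m hr) (Real.exp_pos _).le
  nlinarith

lemma abs_profQ_sub_le (h : IsProfile m C η φ) {r : ℝ} (hr : 0 ≤ r) :
    |profQ m η φ r - Q m r| ≤ 3 * (C + 1) * η * r ^ 2 * Q m r := by
  have h1 := (abs_exp_sub_one_le (h.exponent_le_one hr)).trans
    (mul_le_mul_of_nonneg_left (h.abs_exponent_le hr) (by norm_num))
  have h2 := Q_nonneg m hr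
  rw [profQ, show ∀ q e : ℝ, q * e - q = q * (e - 1) from fun q e => by ring, abs_mul,
    abs_of_nonneg h2]
  calc _ ≤ Q m r * (3 * ((C + 1) * η * r ^ 2)) := by gcongr
    _ = _ := by ring

lemma abs_profQ_sub_le' (h : IsProfile m C η φ) {r : ℝ} (hr : 0 ≤ r) :
    |profQ m η φ r - Q m r| ≤ 3 * Q m r := by
  have h1 := h.profQ_le hr
  have h2 : 0 ≤ profQ m η φ r := mul_nonneg (Q_nonneg m hr) (Real.exp_pos _).le
  have h3 := Q_nonneg m hr
  rw [abs_le]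
  constructor <;> linarith

end IsProfile

/-! ### Uniform bounds inside and outside R_η, with B = 2 -/

lemma Rad_pos {η : ℝ} (hη : 0 < η) : 0 < Rad 2 η := Real.rpow_pos_of_pos (by positivity) _

lemma mul_Rad_sq {η : ℝ} (hη : 0 < η) : η * Rad 2 η ^ 2 = 1 / 2 := by
  rw [Rad, ← Real.rpow_natCast, ← Real.rpow_mul (by positivity)]
  norm_num
  rw [Real.rpow_neg_one]
  field_simp

namespace IsProfile

variable {m : ℕ} {C η : ℝ} {φ : ℝ → ℝ}

/-- Beyond R_η the logarithmic derivative of P is below -1/r, so rP decreases; at R_η, φ is bounded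
and P is comparable to Q. Controlling rP rather than P absorbs the factor ηr produced by
differentiating the Gaussian. -/
lemma profP_le (h : IsProfile m C η φ) (hm : 1 ≤ m) (hη : 0 < η) {r : ℝ} (hr : Rad 2 η ≤ r) :
    r * profP m φ r ≤ Rad 2 η * (3 * Q m (Rad 2 η)) := by
  set R := Rad 2 η with hR
  have hR0 : 0 < R := Rad_pos hη
  have hR2 : η * R ^ 2 = 1 / 2 := mul_Rad_sq hη
  -- From ηR² = 1/2 and 4(m+1)η ≤ 1.
  have hR2' : 2 * ((m : ℝ) + 1) ≤ R ^ 2 := by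
    have := h.small'
    by_contra hlt
    push Not at hlt
    nlinarith
  have hR1 : 1 ≤ R ^ 2 := by
    have : (0 : ℝ) ≤ m := by positivity
    linarith
  have hpow : ∀ u, R ≤ u → 2 * ((m : ℝ) + 1) ≤ u ^ (2 * (m + 1)) := by
    intro u hu
    have h1 : R ^ 2 ≤ u ^ 2 := by gcongr
    rw [pow_mul]
    have h2 : u ^ 2 ≤ (u ^ 2) ^ (m + 1) := le_self_pow₀ (hR1.trans h1) (by omega)
    linarith
  have hder : ∀ u, 0 < u → HasDerivAt (fun u => u * profP m φ u)
      ((1 + angular m η φ u) * profP m φ u) u := by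
    intro u hu
    refine ((hasDerivAt_id u).mul (h.hasDerivAt_profP hu)).congr_deriv ?_
    simp only [id]
    field_simp
  have hanti : AntitoneOn (fun u => u * profP m φ u) (Ici R) := by
    refine antitoneOn_of_hasDerivWithinAt_nonpos (f' := fun u =>
      (1 + angular m η φ u) * profP m φ u) (convex_Ici _) ?_ ?_ ?_
    · exact fun u hu => (hder u (hR0.trans_le hu)).continuousAt.continuousWithinAt
    · intro u hu
      rw [interior_Ici] at hu
      exact (hder u (hR0.trans hu)).hasDerivWithinAt
    · intro u hu
      rw [interior_Ici] at hu
      have hu0 : 0 < u := hR0.trans hu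
      have h1 := h.angular_le hm hu0.le (hpow u (le_of_lt hu))
      have h2 := profP_pos m φ hu0
      nlinarith
  refine (hanti (mem_Ici.2 le_rfl) hr hr).trans ?_
  have h3 := Q_pos m hR0
  change R * profP m φ R ≤ _
  rw [profP, mul_comm (Q m R)]
  gcongr
  refine le_trans ?_ exp_one_lt_three.le
  rw [Real.exp_le_exp]
  have h4 := (le_abs_self _).trans (h.bound R hR0.le)
  linarith

lemma abs_deriv_profQ_le (h : IsProfile m C η φ) {r : ℝ} (hr : 0 < r) :
    |deriv (profQ m η φ) r| ≤ (3 * ((m : ℝ) + 1) / r + η * r / 2) * profQ m η φ r := by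
  have hη := h.nonneg
  rw [(h.hasDerivAt_profQ hr).deriv, abs_mul, abs_of_pos (profQ_pos m η φ hr)]
  have h1 := profQ_pos m η φ hr
  gcongr
  refine (abs_sub _ _).trans ?_
  rw [abs_div, abs_of_pos hr, abs_of_nonneg (by positivity : 0 ≤ η * r / 2)]
  have := h.abs_angular_le hr.le
  gcongr

theorem uniform_bound (h : IsProfile m C η φ) {ℓ : ℕ} (hℓ : ℓ ≤ 1) {r : ℝ} (hr : 0 < r) :
    |iteratedDeriv ℓ (profQ m η φ) r| ≤ 3 * (3 * ((m : ℝ) + 1) + 4) * ((r ^ ℓ)⁻¹ * Q m r) := by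
  have hQ := Q_pos m hr
  have hm' : (0 : ℝ) ≤ m := by positivity
  interval_cases ℓ
  · rw [iteratedDeriv_zero, abs_of_pos (profQ_pos m η φ hr), pow_zero, inv_one, one_mul]
    refine (h.profQ_le hr.le).trans ?_
    gcongr
    linarith
  · rw [iteratedDeriv_one, pow_one]
    have hη := h.nonneg
    have ht : 0 ≤ η * r ^ 2 / 8 := by positivity
    have h2 : Real.exp (-(η * r ^ 2 / 8)) ≤ 1 := by rw [Real.exp_le_one_iff]; linarith
    -- The factor ηr from the Gaussian is absorbed by t e^{-t} ≤ 1 with t = η r²/8.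
    have h3 : η * r ^ 2 / 8 * Real.exp (-(η * r ^ 2 / 8)) ≤ 1 := by
      rw [Real.exp_neg, ← div_eq_mul_inv, div_le_one (Real.exp_pos _)]
      linarith [Real.add_one_le_exp (η * r ^ 2 / 8)]
    calc _ ≤ (3 * ((m : ℝ) + 1) / r + η * r / 2) * profQ m η φ r := h.abs_deriv_profQ_le hr
      _ ≤ (3 * ((m : ℝ) + 1) / r + η * r / 2) * (3 * Real.exp (-(η * r ^ 2 / 8)) * Q m r) := by
          gcongr
          exact h.profQ_le_exp hr.le
      _ = 3 * (3 * ((m : ℝ) + 1) * Real.exp (-(η * r ^ 2 / 8)) +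
          4 * (η * r ^ 2 / 8 * Real.exp (-(η * r ^ 2 / 8)))) * (r⁻¹ * Q m r) := by
          field_simp
          ring
      _ ≤ 3 * (3 * ((m : ℝ) + 1) * 1 + 4 * 1) * (r⁻¹ * Q m r) := by gcongr
      _ = _ := by ring

theorem refined_bound (h : IsProfile m C η φ) (hm : 1 ≤ m) {ℓ : ℕ} (hℓ : ℓ ≤ 1) {r : ℝ}
    (hr : 0 < r) :
    |iteratedDeriv ℓ (profQ m η φ) r| ≤ 3 * (3 * ((m : ℝ) + 1) + 4) *
      ((inner 2 η).indicator (fun s => (s ^ ℓ)⁻¹ * Q m s) r +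
        (outer 2 η).indicator (fun s => (Rad 2 η ^ ℓ)⁻¹ * Q m (Rad 2 η) *
          Real.exp (-(η * s ^ 2 / 4))) r) := by
  have hm' : (0 : ℝ) ≤ m := by positivity
  have hc : 0 ≤ 3 * (3 * ((m : ℝ) + 1) + 4) := by positivity
  by_cases hin : r ∈ inner 2 η
  · refine (h.uniform_bound hℓ hr).trans (mul_le_mul_of_nonneg_left ?_ hc)
    rw [indicator_of_mem hin]
    refine le_add_of_nonneg_right (indicator_nonneg (fun s hs => ?_) _)
    have hR := Rad_pos hs.1
    have := Q_pos m hR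
    positivity
  · have hη : 0 < η := lt_of_le_of_ne h.nonneg fun h0 => hin ⟨hr, Or.inl h0.symm⟩
    have hR : Rad 2 η ≤ r := by
      by_contra hlt
      exact hin ⟨hr, Or.inr (le_of_not_ge hlt)⟩
    have hout : r ∈ outer 2 η := ⟨hη, hR⟩
    rw [indicator_of_notMem hin, indicator_of_mem hout, zero_add]
    have hR0 := Rad_pos hη
    have hR2 := mul_Rad_sq hη
    set R := Rad 2 η
    have hQR := Q_pos m hR0
    have hP := h.profP_le hm hη hR
    have hP0 := profP_pos m φ hr
    have hPle : profP m φ r ≤ 3 * Q m R := by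
      by_contra hlt
      push Not at hlt
      nlinarith
    interval_cases ℓ
    · rw [iteratedDeriv_zero, abs_of_pos (profQ_pos m η φ hr), pow_zero, inv_one, one_mul,
        profQ_eq, mul_comm, ← mul_assoc]
      gcongr
      refine hPle.trans ?_
      gcongr
      linarith
    · rw [iteratedDeriv_one, pow_one]
      have h1 : (3 * ((m : ℝ) + 1) / r + η * r / 2) * profP m φ r ≤
          3 * (3 * ((m : ℝ) + 1) + 4) * (R⁻¹ * Q m R) := by
        have h2 : 3 * ((m : ℝ) + 1) / r * profP m φ r ≤ 3 * ((m : ℝ) + 1) / R * (3 * Q m R) := by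
          gcongr
        have h3 : η * r / 2 * profP m φ r ≤ 3 / 4 * (R⁻¹ * Q m R) := by
          calc η * r / 2 * profP m φ r = η / 2 * (r * profP m φ r) := by ring
            _ ≤ η / 2 * (R * (3 * Q m R)) := by gcongr
            _ = (η * R ^ 2) * (3 / 2) * (R⁻¹ * Q m R) := by field_simp
            _ = _ := by rw [hR2]; ring
        have h4 : 0 < R⁻¹ * Q m R := by positivity
        calc _ ≤ 3 * ((m : ℝ) + 1) / R * (3 * Q m R) + 3 / 4 * (R⁻¹ * Q m R) := by
              rw [add_mul]; exact add_le_add h2 h3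
          _ = (9 * ((m : ℝ) + 1) + 3 / 4) * (R⁻¹ * Q m R) := by field_simp; ring
          _ ≤ _ := by gcongr; linarith
      calc _ ≤ (3 * ((m : ℝ) + 1) / r + η * r / 2) * profQ m η φ r := h.abs_deriv_profQ_le hr
        _ = (3 * ((m : ℝ) + 1) / r + η * r / 2) * profP m φ r * Real.exp (-(η * r ^ 2 / 4)) := by
            rw [profQ_eq]; ring
        _ ≤ 3 * (3 * ((m : ℝ) + 1) + 4) * (R⁻¹ * Q m R) * Real.exp (-(η * r ^ 2 / 4)) := by
            gcongr
        _ = _ := by ring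

/-- Second-order Taylor expansion of e^x at x = (φ - η r²/2)/2: replacing φ by η φ₁ turns the linear
term Qx into -η(m+1)ρ. -/
theorem abs_sub_add_modeOf_le (h : IsProfile m C η φ) {φ₁ : ℝ → ℝ} {D r : ℝ} (hr : 0 ≤ r)
    (hD : |φ r - η * φ₁ r| ≤ D * (η ^ 2 * r ^ 4)) :
    |profQ m η φ r - Q m r + η * (((m : ℝ) + 1) * modeOf m φ₁ r)| ≤
      ((C + 1) ^ 2 + D) * (η ^ 2 * r ^ 4 * Q m r) := by
  have hQ := Q_nonneg m hr
  have hn : (0 : ℝ) < (m : ℝ) + 1 := by positivity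
  have h1 := abs_exp_sub_one_sub_self_le (h.exponent_le_one hr)
  have h2 : ((φ r - η * r ^ 2 / 2) / 2) ^ 2 ≤ (C + 1) ^ 2 * (η ^ 2 * r ^ 4) := by
    rw [← sq_abs]
    calc _ ≤ ((C + 1) * η * r ^ 2) ^ 2 := by gcongr; exact h.abs_exponent_le hr
      _ = _ := by ring
  have h3 : profQ m η φ r - Q m r + η * (((m : ℝ) + 1) * modeOf m φ₁ r) =
      Q m r * ((Real.exp ((φ r - η * r ^ 2 / 2) / 2) - 1 - (φ r - η * r ^ 2 / 2) / 2) +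
        (φ r - η * φ₁ r) / 2) := by
    rw [profQ, modeOf]
    field_simp
    ring
  rw [h3, abs_mul, abs_of_nonneg hQ]
  have h4 : |(φ r - η * φ₁ r) / 2| ≤ D * (η ^ 2 * r ^ 4) := by
    rw [abs_div, abs_two]
    linarith [abs_nonneg (φ r - η * φ₁ r)]
  calc _ ≤ Q m r * ((C + 1) ^ 2 * (η ^ 2 * r ^ 4) + D * (η ^ 2 * r ^ 4)) := by
        gcongr
        exact (abs_add_le _ _).trans (add_le_add (h1.trans h2) h4)
    _ = _ := by ring

end IsProfile

/-- If `f' = y / r` and `y → l` at infinity, then `f / log r → l`. -/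
lemma tendsto_div_log_of_hasDerivAt {f y : ℝ → ℝ} {l : ℝ}
    (hf : ∀ r > 0, HasDerivAt f (y r / r) r) (hy : Tendsto y atTop (𝓝 l)) :
    Tendsto (fun r => f r / Real.log r) atTop (𝓝 l) := by
  rw [Metric.tendsto_atTop]
  intro ε hε
  obtain ⟨N, hN⟩ := Metric.tendsto_atTop.1 hy (ε / 2) (by positivity)
  set a := max N 1 with ha
  have ha1 : 1 ≤ a := le_max_right _ _
  have ha0 : 0 < a := by linarith
  have hlim : Tendsto (fun r => |f a - l * Real.log a| / Real.log r) atTop (𝓝 0) :=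
    tendsto_const_nhds.div_atTop Real.tendsto_log_atTop
  obtain ⟨M, hM⟩ := (hlim.eventually (gt_mem_nhds (by positivity : 0 < ε / 2))).exists_forall_of_atTop
  refine ⟨max M (a + 1), fun r hr => ?_⟩
  have hMr := hM r ((le_max_left _ _).trans hr)
  have har : a < r := by linarith [(le_max_right M (a + 1)).trans hr]
  have hr0 : 0 < r := ha0.trans har
  have hlog : 0 < Real.log r := Real.log_pos (by linarith)
  have hloga : 0 ≤ Real.log a := Real.log_nonneg ha1
  have hlogar : Real.log a < Real.log r := Real.log_lt_log ha0 har
  -- Cauchy's mean value theorem against log: the ratio of derivatives is exactly y(c), already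
  -- close to l.
  obtain ⟨c, hc, hc'⟩ := exists_ratio_hasDerivAt_eq_ratio_slope f (fun r => y r / r) har
    (fun x hx => (hf x (ha0.trans_le hx.1)).continuousAt.continuousWithinAt)
    (fun x hx => hf x (ha0.trans hx.1)) Real.log (fun x => x⁻¹)
    (fun x hx => (Real.hasDerivAt_log (ha0.trans_le hx.1).ne').continuousAt.continuousWithinAt)
    (fun x hx => Real.hasDerivAt_log (ha0.trans hx.1).ne')
  have hc0 : 0 < c := ha0.trans hc.1
  have hc2 : f r - f a = y c * (Real.log r - Real.log a) := by
    field_simp at hc'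
    linarith
  have hyc : |y c - l| < ε / 2 := by
    simpa [Real.dist_eq] using hN c ((le_max_left N 1).trans hc.1.le)
  have h1 : f r / Real.log r - l =
      (f a - l * Real.log a) / Real.log r + (y c - l) * ((Real.log r - Real.log a) / Real.log r) := by
    rw [show f r = f a + y c * (Real.log r - Real.log a) by linarith]
    field_simp
    ring
  have h2 : |(Real.log r - Real.log a) / Real.log r| ≤ 1 := by
    rw [abs_of_nonneg (div_nonneg (by linarith) hlog.le), div_le_one hlog]
    linarith
  rw [Real.dist_eq, h1]
  calc _ ≤ |(f a - l * Real.log a) / Real.log r| +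
        |(y c - l) * ((Real.log r - Real.log a) / Real.log r)| := abs_add_le _ _
    _ ≤ |f a - l * Real.log a| / Real.log r + |y c - l| * 1 := by
        rw [abs_div, abs_of_pos hlog, abs_mul]
        gcongr
    _ < ε := by linarith

/-- The limit of the logarithmic derivative of `P` at infinity. -/
def angularLimit (m : ℕ) (η : ℝ) (φ : ℝ → ℝ) : ℝ :=
  (m : ℝ) - 1 / 2 * ∫ r in Ioi (0 : ℝ), |profQ m η φ r| ^ 2 * r

/-- `∫_0^∞ r³ (Q^{(η)})² dr`. -/
def profMoment (m : ℕ) (η : ℝ) (φ : ℝ → ℝ) : ℝ := ∫ r in Ioi (0 : ℝ), r ^ 3 * profQ m η φ r ^ 2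

/-! ### Decay exponent of P and the Pohozaev identity -/

namespace IsProfile

variable {m : ℕ} {C η : ℝ} {φ : ℝ → ℝ}

lemma integrableOn_pow_mul_profQ_sq (h : IsProfile m C η φ) {p : ℕ} (hp : p ≤ 2 * m + 2) :
    IntegrableOn (fun r => r ^ p * profQ m η φ r ^ 2) (Ioi (0 : ℝ)) := by
  have hc : Continuous fun r => r ^ p * profQ m η φ r ^ 2 :=
    (continuous_pow p).mul (h.continuous_profQ.pow 2)
  refine Integrable.mono' ((integrableOn_pow_mul_Q_sq m p hp).const_mul 9)
    hc.aestronglyMeasurable.restrict ?_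
  refine (ae_restrict_mem measurableSet_Ioi).mono fun r hr => ?_
  have hr0 : (0 : ℝ) < r := hr
  rw [Real.norm_of_nonneg (by positivity)]
  have := h.profQ_sq_le hr0.le
  calc r ^ p * profQ m η φ r ^ 2 ≤ r ^ p * (9 * Q m r ^ 2) := by gcongr
    _ = _ := by ring

lemma squareIntegrable_profQ (h : IsProfile m C η φ) : SquareIntegrable (profQ m η φ) := by
  have := h.integrableOn_pow_mul_profQ_sq (p := 1) (by omega)
  refine this.congr_fun (fun r _ => ?_) measurableSet_Ioi
  simp only [pow_one, sq_abs, mul_comm]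

lemma squareIntegrable_sub (h : IsProfile m C η φ) :
    SquareIntegrable fun r => profQ m η φ r - Q m r := by
  have hQ := Q_continuous m
  have hP := h.continuous_profQ
  have hc : Continuous fun r => |profQ m η φ r - Q m r| ^ 2 * r := by fun_prop
  refine Integrable.mono' ((integrableOn_pow_mul_Q_sq m 1 (by omega)).const_mul 9)
    hc.aestronglyMeasurable.restrict ?_
  refine (ae_restrict_mem measurableSet_Ioi).mono fun r hr => ?_
  have hr0 : (0 : ℝ) < r := hr
  rw [Real.norm_of_nonneg (by positivity)]
  calc |profQ m η φ r - Q m r| ^ 2 * r ≤ (3 * Q m r) ^ 2 * r := by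
        gcongr; exact h.abs_profQ_sub_le' hr0.le
    _ = _ := by ring

lemma tendsto_angular (h : IsProfile m C η φ) :
    Tendsto (angular m η φ) atTop (𝓝 (angularLimit m η φ)) := by
  have h1 := intervalIntegral_tendsto_integral_Ioi 0 h.squareIntegrable_profQ tendsto_id
  have h2 := (h1.const_mul (1 / 2)).const_sub (m : ℝ)
  refine h2.congr fun r => ?_
  simp only [angular, Atheta, id]
  ring

lemma tendsto_log_profP (h : IsProfile m C η φ) :
    Tendsto (fun r => Real.log (profP m φ r) / Real.log r) atTop (𝓝 (angularLimit m η φ)) := by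
  refine tendsto_div_log_of_hasDerivAt (y := angular m η φ) (fun r hr => ?_) h.tendsto_angular
  have hP := profP_pos m φ hr
  refine ((h.hasDerivAt_profP hr).log hP.ne').congr_deriv ?_
  field_simp

lemma angularLimit_le (h : IsProfile m C η φ) (hm : 1 ≤ m) : angularLimit m η φ ≤ -3 / 2 := by
  refine le_of_tendsto h.tendsto_angular ?_
  have h1 : Tendsto (fun r : ℝ => r ^ (2 * (m + 1))) atTop atTop := tendsto_pow_atTop (by omega)
  filter_upwards [h1.eventually_ge_atTop (2 * ((m : ℝ) + 1)), eventually_ge_atTop 0] with r h2 h3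
  exact h.angular_le hm h3 h2

/-- A Pohozaev identity for the deformed profile. -/
lemma pohozaev (h : IsProfile m C η φ) {r : ℝ} (hr : 0 < r) :
    2 * (1 + angular m η φ r) ^ 2 + r ^ 2 * profQ m η φ r ^ 2 +
      η * ∫ s in (0 : ℝ)..r, s ^ 3 * profQ m η φ s ^ 2 = 2 * ((m : ℝ) + 1) ^ 2 := by
  have hP := h.continuous_profQ
  have hc₁ : Continuous fun s => s * profQ m η φ s ^ 2 := by fun_prop
  have hc₃ : Continuous fun s => s ^ 3 * profQ m η φ s ^ 2 := by fun_prop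
  have hFTC : ∀ {g : ℝ → ℝ}, Continuous g → ∀ u,
      HasDerivAt (fun u => ∫ s in (0 : ℝ)..u, g s) (g u) u := fun hg u =>
    intervalIntegral.integral_hasDerivAt_right (hg.intervalIntegrable _ _)
      hg.stronglyMeasurable.stronglyMeasurableAtFilter hg.continuousAt
  have hang : ∀ u, angular m η φ u = (m : ℝ) - 1 / 2 * ∫ s in (0 : ℝ)..u, s * profQ m η φ s ^ 2 := by
    intro u
    simp only [angular, Atheta, sq_abs, mul_comm (profQ m η φ _ ^ 2)]
    ring
  have hA : ∀ u, HasDerivAt (angular m η φ) (-(1 / 2 * (u * profQ m η φ u ^ 2))) u := by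
    intro u
    rw [show angular m η φ = _ from funext hang]
    exact ((hFTC hc₁ u).const_mul (1 / 2)).const_sub (m : ℝ)
  set E : ℝ → ℝ := fun r => 2 * (1 + angular m η φ r) ^ 2 + r ^ 2 * profQ m η φ r ^ 2 +
      η * ∫ s in (0 : ℝ)..r, s ^ 3 * profQ m η φ s ^ 2 with hE
  have hAc : Continuous (angular m η φ) := continuous_iff_continuousAt.2 fun u => (hA u).continuousAt
  have hIc : Continuous fun r => ∫ s in (0 : ℝ)..r, s ^ 3 * profQ m η φ s ^ 2 :=
    continuous_iff_continuousAt.2 fun u => (hFTC hc₃ u).continuousAt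
  have hEc : Continuous E := by fun_prop
  -- With a = m + A_θ, a' = -r|Q^{(η)}|²/2 and the logarithmic derivative of Q^{(η)} is a/r - ηr/2,
  -- so all terms of E' cancel.
  have hEd : ∀ u, 0 < u → HasDerivAt E 0 u := by
    intro u hu
    have h1 := (((hA u).const_add 1).pow 2).const_mul 2
    have h2 := (hasDerivAt_pow 2 u).mul ((h.hasDerivAt_profQ hu).pow 2)
    have h3 := (hFTC hc₃ u).const_mul η
    refine ((h1.add h2).add h3).congr_deriv ?_
    simp only [Pi.pow_apply]
    push_cast
    field_simp
    ring
  obtain ⟨c, _, hc⟩ := exists_hasDerivAt_eq_slope E (fun _ => 0) hr hEc.continuousOn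
    fun u hu => hEd u hu.1
  have h4 : E r = E 0 := by
    rw [eq_comm, div_eq_zero_iff] at hc
    rcases hc with hc | hc <;> linarith
  change E r = _
  rw [h4, hE]
  simp only [hang, intervalIntegral.integral_same]
  ring

lemma pohozaev_limit (h : IsProfile m C η φ) (hm : 1 ≤ m) :
    2 * (1 + angularLimit m η φ) ^ 2 + η * profMoment m η φ = 2 * ((m : ℝ) + 1) ^ 2 := by
  have h1 := intervalIntegral_tendsto_integral_Ioi 0
    (h.integrableOn_pow_mul_profQ_sq (p := 3) (by omega)) tendsto_id
  have h2 : Tendsto (fun r : ℝ => r ^ 2 * profQ m η φ r ^ 2) atTop (𝓝 0) := by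
    have h3 : Tendsto (fun r : ℝ => 9 * (8 * ((m : ℝ) + 1) ^ 2) * (r ^ 1)⁻¹) atTop (𝓝 0) := by
      have := (tendsto_inv_atTop_zero (𝕜 := ℝ)).const_mul (9 * (8 * ((m : ℝ) + 1) ^ 2))
      simpa using this
    refine squeeze_zero' (Eventually.of_forall fun r => by positivity) ?_ h3
    filter_upwards [eventually_ge_atTop 1] with r hr
    have h4 := h.profQ_sq_le (zero_le_one.trans hr)
    have h5 := pow_mul_Q_sq_le m 2 1 (by omega) hr
    calc r ^ 2 * profQ m η φ r ^ 2 ≤ r ^ 2 * (9 * Q m r ^ 2) := by gcongr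
      _ ≤ _ := by linarith
  have h6 := ((((h.tendsto_angular.const_add 1).pow 2).const_mul 2).add h2).add (h1.const_mul η)
  rw [add_zero] at h6
  refine tendsto_nhds_unique h6 (tendsto_const_nhds.congr' ?_)
  filter_upwards [eventually_gt_atTop 0] with r hr
  exact (h.pohozaev hr).symm

lemma profMoment_pos (h : IsProfile m C η φ) (hm : 1 ≤ m) : 0 < profMoment m η φ := by
  have hP := h.continuous_profQ
  have hc : Continuous fun s => s ^ 3 * profQ m η φ s ^ 2 := by fun_prop
  have h1 : 0 < ∫ s in (0 : ℝ)..1, s ^ 3 * profQ m η φ s ^ 2 := by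
    refine intervalIntegral.intervalIntegral_pos_of_pos_on (hc.intervalIntegrable _ _)
      (fun s hs => ?_) one_pos
    have := profQ_pos m η φ hs.1
    have := hs.1
    positivity
  refine h1.trans_le ?_
  rw [intervalIntegral.integral_of_le zero_le_one]
  refine setIntegral_mono_set (h.integrableOn_pow_mul_profQ_sq (by omega)) ?_
    Ioc_subset_Ioi_self.eventuallyLE
  refine (ae_restrict_mem measurableSet_Ioi).mono fun s hs => ?_
  have : (0 : ℝ) < s := hs
  simp only [Pi.zero_apply]
  positivity

lemma lt_angularLimit (h : IsProfile m C η φ) (hm : 1 ≤ m) (hη : 0 < η) :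
    -((m : ℝ) + 2) < angularLimit m η φ := by
  have h1 := h.pohozaev_limit hm
  have h2 := mul_pos hη (h.profMoment_pos hm)
  have hm' : (0 : ℝ) ≤ m := by positivity
  by_contra hlt
  push Not at hlt
  nlinarith

end IsProfile

/-- Dominated convergence: the profiles converge pointwise to Q and are bounded by 3Q. -/
lemma tendsto_profMoment {m : ℕ} (hm : 1 ≤ m) {C η₀ : ℝ} (hη₀ : 0 < η₀) {Φ : ℝ → ℝ → ℝ}
    (hΦ : ∀ η ∈ Icc 0 η₀, IsProfile m C η (Φ η)) :
    Tendsto (fun η => profMoment m η (Φ η)) (𝓝[>] 0) (𝓝 (secondMoment m)) := by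
  have hev : ∀ᶠ η in 𝓝[>] (0 : ℝ), η ∈ Icc 0 η₀ :=
    mem_of_superset (Ioc_mem_nhdsGT hη₀) Ioc_subset_Icc_self
  refine tendsto_integral_filter_of_dominated_convergence (fun r => 9 * (r ^ 3 * Q m r ^ 2)) ?_ ?_
    ((integrableOn_pow_mul_Q_sq m 3 (by omega)).const_mul 9) ?_
  · filter_upwards [hev] with η hη
    have := (hΦ η hη).continuous_profQ
    exact Continuous.aestronglyMeasurable (by fun_prop)
  · filter_upwards [hev] with η hη
    refine (ae_restrict_mem measurableSet_Ioi).mono fun r hr => ?_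
    have hr0 : (0 : ℝ) < r := hr
    rw [Real.norm_of_nonneg (by positivity)]
    have := (hΦ η hη).profQ_sq_le hr0.le
    calc r ^ 3 * profQ m η (Φ η) r ^ 2 ≤ r ^ 3 * (9 * Q m r ^ 2) := by gcongr
      _ = _ := by ring
  · refine (ae_restrict_mem measurableSet_Ioi).mono fun r hr => ?_
    have hr0 : (0 : ℝ) < r := hr
    have h1 : Tendsto (fun η => profQ m η (Φ η) r) (𝓝[>] 0) (𝓝 (Q m r)) := by
      rw [tendsto_iff_norm_sub_tendsto_zero]
      have h2 : Tendsto (fun η : ℝ => 3 * (C + 1) * η * r ^ 2 * Q m r) (𝓝[>] 0) (𝓝 0) := by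
        have : Continuous fun η : ℝ => 3 * (C + 1) * η * r ^ 2 * Q m r := by fun_prop
        simpa using (this.tendsto 0).mono_left nhdsWithin_le_nhds
      refine squeeze_zero' (Eventually.of_forall fun η => norm_nonneg _) ?_ h2
      filter_upwards [hev] with η hη
      exact (hΦ η hη).abs_profQ_sub_le hr0.le
    exact (h1.pow 2).const_mul _

/-- First order expansion of the decay exponent. -/
theorem isLittleO_angularLimit {m : ℕ} (hm : 1 ≤ m) {C η₀ : ℝ} (hη₀ : 0 < η₀) {Φ : ℝ → ℝ → ℝ}
    (hΦ : ∀ η ∈ Icc 0 η₀, IsProfile m C η (Φ η)) :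
    (fun η => angularLimit m η (Φ η) -
      (-((m : ℝ) + 2) + η * (secondMoment m / (4 * ((m : ℝ) + 1))))) =o[𝓝[>] 0] fun η => η := by
  have hev : ∀ᶠ η in 𝓝[>] (0 : ℝ), η ∈ Ioc 0 η₀ := Ioc_mem_nhdsGT hη₀
  have hn : (0 : ℝ) < (m : ℝ) + 1 := by positivity
  have hS := tendsto_profMoment hm hη₀ hΦ
  -- In terms of the gap d above -(m+2), the limiting identity factors as d (2(m+1) - d) = η ·
  -- moment / 2. The second factor is at least m+1, so d = O(η), and dividing by it gives the
  -- coefficient.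
  set d : ℝ → ℝ := fun η => angularLimit m η (Φ η) + ((m : ℝ) + 2) with hd
  have hkey : ∀ η ∈ Ioc 0 η₀, d η * (2 * ((m : ℝ) + 1) - d η) = η * profMoment m η (Φ η) / 2 ∧
      0 ≤ d η ∧ (m : ℝ) + 1 ≤ 2 * ((m : ℝ) + 1) - d η := by
    intro η hη
    have h := hΦ η (Ioc_subset_Icc_self hη)
    have h1 := h.pohozaev_limit hm
    have h2 := h.lt_angularLimit hm hη.1
    have h3 := h.angularLimit_le hm
    refine ⟨?_, by simp only [hd]; linarith, by simp only [hd]; linarith⟩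
    simp only [hd]
    linear_combination (-1 / 2) * h1
  have hη0 : Tendsto (fun η : ℝ => η) (𝓝[>] 0) (𝓝 0) := tendsto_id.mono_left nhdsWithin_le_nhds
  have hd0 : Tendsto d (𝓝[>] 0) (𝓝 0) := by
    have h1 : Tendsto (fun η => η * profMoment m η (Φ η) / 2 / ((m : ℝ) + 1)) (𝓝[>] 0) (𝓝 0) := by
      simpa using ((hη0.mul hS).div_const 2).div_const ((m : ℝ) + 1)
    refine squeeze_zero' ?_ ?_ h1
    · filter_upwards [hev] with η hη using (hkey η hη).2.1
    · filter_upwards [hev] with η hη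
      obtain ⟨h2, h3, h4⟩ := hkey η hη
      rw [le_div_iff₀ hn, ← h2]
      gcongr
  have hw : Tendsto (fun η => profMoment m η (Φ η) / 2 / (2 * ((m : ℝ) + 1) - d η) -
      secondMoment m / (4 * ((m : ℝ) + 1))) (𝓝[>] 0) (𝓝 0) := by
    have h1 := ((hS.div_const 2).div (hd0.const_sub (2 * ((m : ℝ) + 1))) (by
      rw [sub_zero]; positivity)).sub_const (secondMoment m / (4 * ((m : ℝ) + 1)))
    rw [show secondMoment m / 2 / (2 * ((m : ℝ) + 1) - 0) -
      secondMoment m / (4 * ((m : ℝ) + 1)) = 0 by field_simp; ring] at h1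
    exact h1
  have hlo := (isBigO_refl (fun η : ℝ => η) (𝓝[>] 0)).mul_isLittleO ((isLittleO_one_iff ℝ).2 hw)
  simp only [mul_one] at hlo
  refine hlo.congr' ?_ EventuallyEq.rfl
  filter_upwards [hev] with η hη
  obtain ⟨h2, h3, h4⟩ := hkey η hη
  have h5 : d η = η * (profMoment m η (Φ η) / 2 / (2 * ((m : ℝ) + 1) - d η)) := by
    have : 2 * ((m : ℝ) + 1) - d η ≠ 0 := by linarith
    rw [mul_div_assoc', eq_div_iff this, h2]
    ring
  rw [mul_sub, ← h5]
  simp only [hd]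
  ring

/-! ### Masses and the L² distance to Q -/

lemma planeIntegral_profQ (m : ℕ) (η : ℝ) (φ : ℝ → ℝ) :
    planeIntegral (fun r => |profQ m η φ r| ^ 2) =
      4 * Real.pi * ((m : ℝ) - angularLimit m η φ) := by
  rw [planeIntegral, angularLimit]
  ring

lemma planeIntegral_Q (m : ℕ) :
    planeIntegral (fun r => |Q m r| ^ 2) = 8 * Real.pi * ((m : ℝ) + 1) := by
  rw [planeIntegral, show (fun r => |Q m r| ^ 2 * r) = fun r => r * Q m r ^ 2 by
    funext s; rw [sq_abs, mul_comm], integral_Ioi_Q_sq m le_rfl, massQ_zero]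
  ring

lemma planeIntegral_mul_Q (m : ℕ) :
    planeIntegral (fun r => |r * Q m r| ^ 2) = 2 * Real.pi * secondMoment m := by
  rw [planeIntegral, secondMoment]
  congr 2
  funext r
  rw [sq_abs]
  ring

lemma integral_pow_five_mul_Q_sq_le (m : ℕ) (hm : 1 ≤ m) {R : ℝ} (hR : 1 ≤ R) :
    ∫ r in (0 : ℝ)..R, r ^ 5 * Q m r ^ 2 ≤
      (∫ r in (0 : ℝ)..1, r ^ 5 * Q m r ^ 2) + 8 * ((m : ℝ) + 1) ^ 2 * Real.log R := by
  have hQ := Q_continuous m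
  have hc : Continuous fun r => r ^ 5 * Q m r ^ 2 := by fun_prop
  rw [← intervalIntegral.integral_add_adjacent_intervals (hc.intervalIntegrable 0 1)
    (hc.intervalIntegrable 1 R)]
  gcongr
  have h0 : (0 : ℝ) ∉ uIcc 1 R := by
    rw [uIcc_of_le hR]
    intro h; linarith [h.1]
  have h1 : ∫ r in (1 : ℝ)..R, 8 * ((m : ℝ) + 1) ^ 2 * (r ^ 1)⁻¹ =
      8 * ((m : ℝ) + 1) ^ 2 * Real.log R := by
    rw [intervalIntegral.integral_const_mul]
    simp only [pow_one]
    rw [integral_inv h0, div_one]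
  rw [← h1]
  refine intervalIntegral.integral_mono_on hR (hc.intervalIntegrable _ _) ?_ fun r hr =>
    pow_mul_Q_sq_le m 5 1 (by omega) hr.1
  refine ContinuousOn.intervalIntegrable fun r hr => ?_
  have : r ≠ 0 := fun h => h0 (h ▸ hr)
  exact (continuousAt_const.mul ((continuousAt_id.pow 1).inv₀ (by simpa))).continuousWithinAt

lemma integral_Ioi_inv_pow_five {R : ℝ} (hR : 0 < R) : ∫ r in Ioi R, (r ^ 5)⁻¹ = (R ^ 4)⁻¹ / 4 := by
  have h1 := integral_Ioi_rpow_of_lt (a := -5) (by norm_num) hR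
  have h2 : ∫ r in Ioi R, (r ^ 5)⁻¹ = ∫ r in Ioi R, r ^ (-5 : ℝ) := by
    refine setIntegral_congr_fun measurableSet_Ioi fun r hr => ?_
    have : 0 < r := hR.trans hr
    rw [Real.rpow_neg this.le]
    norm_cast
  rw [h2, h1, show (-5 : ℝ) + 1 = -4 by norm_num, Real.rpow_neg hR.le,
    show R ^ (4 : ℝ) = R ^ 4 by norm_cast]
  ring

namespace IsProfile

variable {m : ℕ} {C η : ℝ} {φ : ℝ → ℝ}

lemma sq_sub_le (h : IsProfile m C η φ) {r : ℝ} (hr : 0 ≤ r) :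
    |profQ m η φ r - Q m r| ^ 2 * r ≤ 9 * (C + 1) ^ 2 * η ^ 2 * (r ^ 5 * Q m r ^ 2) := by
  calc |profQ m η φ r - Q m r| ^ 2 * r ≤ (3 * (C + 1) * η * r ^ 2 * Q m r) ^ 2 * r := by
        gcongr; exact h.abs_profQ_sub_le hr
    _ = _ := by ring

lemma sq_sub_le' (h : IsProfile m C η φ) {r : ℝ} (hr : 0 ≤ r) :
    |profQ m η φ r - Q m r| ^ 2 * r ≤ 9 * (r ^ 1 * Q m r ^ 2) := by
  calc |profQ m η φ r - Q m r| ^ 2 * r ≤ (3 * Q m r) ^ 2 * r := by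
        gcongr; exact h.abs_profQ_sub_le' hr
    _ = _ := by ring

/-- The `L²` bound away from the endpoint case `m = 1`. -/
theorem integral_sq_sub_le (h : IsProfile m C η φ) (hm : 2 ≤ m) :
    ∫ r in Ioi (0 : ℝ), |profQ m η φ r - Q m r| ^ 2 * r ≤
      9 * (C + 1) ^ 2 * (∫ r in Ioi (0 : ℝ), r ^ 5 * Q m r ^ 2) * η ^ 2 := by
  have h1 := (integrableOn_pow_mul_Q_sq m 5 (by omega)).const_mul (9 * (C + 1) ^ 2 * η ^ 2)
  have h2 := setIntegral_mono_on h.squareIntegrable_sub h1 measurableSet_Ioi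
    fun r hr => h.sq_sub_le (le_of_lt hr)
  rw [integral_const_mul] at h2
  linarith

/-- The logarithmically corrected `L²` bound, needed for `m = 1`. -/
theorem integral_sq_sub_le_log (h : IsProfile m C η φ) (hm : 1 ≤ m) (hη : 0 < η)
    (hη' : η ≤ 1 / 3) :
    ∫ r in Ioi (0 : ℝ), |profQ m η φ r - Q m r| ^ 2 * r ≤
      (9 * (C + 1) ^ 2 * ((∫ r in (0 : ℝ)..1, r ^ 5 * Q m r ^ 2) + 8 * ((m : ℝ) + 1) ^ 2) +
        18 * ((m : ℝ) + 1) ^ 2) * (η ^ 2 * |Real.log η|) := by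
  have hQ := Q_continuous m
  have hP := h.continuous_profQ
  -- R = η^{-1/2} is the scale where the bounds η r² Q and Q cross. The inner part gives η² log R;
  -- the tail gives R^{-4} = η².
  set R := (√η)⁻¹ with hRdef
  have hs : 0 < √η := Real.sqrt_pos.2 hη
  have hR0 : 0 < R := inv_pos.2 hs
  have hsq : √η ^ 2 = η := Real.sq_sqrt hη.le
  have hR4 : (R ^ 4)⁻¹ = η ^ 2 := by
    rw [hRdef, inv_pow, inv_inv, show √η ^ 4 = (√η ^ 2) ^ 2 by ring, hsq]
  have hR1 : 1 ≤ R := by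
    rw [hRdef, one_le_inv₀ hs, Real.sqrt_le_left zero_le_one]
    linarith
  have hlogR : Real.log R = -Real.log η / 2 := by
    rw [hRdef, Real.log_inv, Real.log_sqrt hη.le]; ring
  -- η ≤ 1/3 < e⁻¹ gives |log η| ≥ 1, which absorbs the terms without logarithm.
  have hlog1 : Real.log η ≤ -1 := by
    rw [Real.log_le_iff_le_exp hη, Real.exp_neg]
    refine hη'.trans ?_
    rw [one_div]
    exact inv_anti₀ (Real.exp_pos _) exp_one_lt_three.le
  have habs : |Real.log η| = -Real.log η := abs_of_nonpos (by linarith)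
  have hsub := h.squareIntegrable_sub
  rw [SquareIntegrable] at hsub
  have hsplit : ∫ r in Ioi (0 : ℝ), |profQ m η φ r - Q m r| ^ 2 * r =
      (∫ r in (0 : ℝ)..R, |profQ m η φ r - Q m r| ^ 2 * r) +
        ∫ r in Ioi R, |profQ m η φ r - Q m r| ^ 2 * r := by
    rw [intervalIntegral.integral_of_le hR0.le, ← setIntegral_union (Ioc_disjoint_Ioi le_rfl)
      measurableSet_Ioi (hsub.mono_set Ioc_subset_Ioi_self)
      (hsub.mono_set (Ioi_subset_Ioi hR0.le)), Ioc_union_Ioi_eq_Ioi hR0.le]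
  have h1 : ∫ r in (0 : ℝ)..R, |profQ m η φ r - Q m r| ^ 2 * r ≤
      9 * (C + 1) ^ 2 * η ^ 2 * ∫ r in (0 : ℝ)..R, r ^ 5 * Q m r ^ 2 := by
    rw [← intervalIntegral.integral_const_mul]
    refine intervalIntegral.integral_mono_on hR0.le
      (Continuous.intervalIntegrable (by fun_prop) _ _)
      (Continuous.intervalIntegrable (by fun_prop) _ _) fun r hr => h.sq_sub_le hr.1
  have h2 : ∫ r in Ioi R, |profQ m η φ r - Q m r| ^ 2 * r ≤ 18 * ((m : ℝ) + 1) ^ 2 * η ^ 2 := by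
    have h3 : ∫ r in Ioi R, |profQ m η φ r - Q m r| ^ 2 * r ≤
        ∫ r in Ioi R, 9 * (8 * ((m : ℝ) + 1) ^ 2) * (r ^ 5)⁻¹ := by
      refine setIntegral_mono_on (hsub.mono_set (Ioi_subset_Ioi hR0.le))
        ((integrableOn_inv_pow hR0 5 (by norm_num)).const_mul _) measurableSet_Ioi fun r hr => ?_
      have hr' : R < r := hr
      have h4 := h.sq_sub_le' (hR0.trans hr').le
      have h5 := pow_mul_Q_sq_le m 1 5 (by omega) (hR1.trans hr'.le)
      linarith
    rw [integral_const_mul, integral_Ioi_inv_pow_five hR0, hR4] at h3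
    linarith
  have h6 := integral_pow_five_mul_Q_sq_le m hm hR1
  rw [hlogR] at h6
  have hA : 0 ≤ ∫ r in (0 : ℝ)..1, r ^ 5 * Q m r ^ 2 :=
    intervalIntegral.integral_nonneg zero_le_one fun r hr => by
      have := hr.1
      positivity
  set A := ∫ r in (0 : ℝ)..1, r ^ 5 * Q m r ^ 2
  have hn : (0 : ℝ) < 8 * ((m : ℝ) + 1) ^ 2 := by positivity
  have h7 : ∫ r in (0 : ℝ)..R, r ^ 5 * Q m r ^ 2 ≤
      (A + 8 * ((m : ℝ) + 1) ^ 2) * |Real.log η| := by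
    rw [habs]
    nlinarith
  have h8 : 18 * ((m : ℝ) + 1) ^ 2 * η ^ 2 ≤ 18 * ((m : ℝ) + 1) ^ 2 * (η ^ 2 * |Real.log η|) := by
    gcongr
    refine le_mul_of_one_le_right (by positivity) ?_
    rw [habs]; linarith
  rw [hsplit]
  calc _ ≤ 9 * (C + 1) ^ 2 * η ^ 2 * ((A + 8 * ((m : ℝ) + 1) ^ 2) * |Real.log η|) +
        18 * ((m : ℝ) + 1) ^ 2 * (η ^ 2 * |Real.log η|) := by
        refine add_le_add (h1.trans ?_) (h2.trans h8)
        gcongr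
    _ = _ := by ring

end IsProfile

lemma l2norm_le_of_integral_le {f : ℝ → ℝ} {K a : ℝ} (ha : 0 ≤ a)
    (h : ∫ r in Ioi (0 : ℝ), |f r| ^ 2 * r ≤ K * a ^ 2) :
    l2norm f ≤ √(2 * Real.pi * K) * a := by
  rw [l2norm, planeIntegral]
  calc √(2 * Real.pi * ∫ r in Ioi (0 : ℝ), |f r| ^ 2 * r) ≤ √(2 * Real.pi * K * a ^ 2) := by
        refine Real.sqrt_le_sqrt ?_
        rw [mul_assoc (2 * Real.pi)]
        exact mul_le_mul_of_nonneg_left h (by positivity)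
    _ = _ := by rw [Real.sqrt_mul' _ (sq_nonneg a), Real.sqrt_sq ha]

theorem exists_l2norm_le {m : ℕ} (hm : 1 ≤ m) (C : ℝ) : ∃ K, ∀ η φ, η ≤ 1 / 3 →
    IsProfile m C η φ → l2norm (fun r => profQ m η φ r - Q m r) ≤
      K * (if m = 1 then η * √|Real.log η| else η) := by
  by_cases h1 : m = 1
  · simp only [if_pos h1]
    refine ⟨√(2 * Real.pi * (9 * (C + 1) ^ 2 *
      ((∫ r in (0 : ℝ)..1, r ^ 5 * Q m r ^ 2) + 8 * ((m : ℝ) + 1) ^ 2) +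
        18 * ((m : ℝ) + 1) ^ 2)), fun η φ hη' h => ?_⟩
    refine l2norm_le_of_integral_le (mul_nonneg h.nonneg (Real.sqrt_nonneg _)) ?_
    -- At η = 0 the right side vanishes, so the difference must vanish exactly.
    rcases h.nonneg.eq_or_lt with h0 | hη
    · have : ∫ r in Ioi (0 : ℝ), |profQ m η φ r - Q m r| ^ 2 * r = 0 := by
        refine setIntegral_eq_zero_of_forall_eq_zero fun r hr => ?_
        have hr0 : (0 : ℝ) ≤ r := le_of_lt hr
        have h2 := h.sq_sub_le hr0
        rw [← h0] at h2 ⊢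
        refine le_antisymm (h2.trans (le_of_eq (by ring))) (by positivity)
      rw [this, ← h0]
      simp
    · rw [mul_pow, Real.sq_sqrt (abs_nonneg _)]
      exact h.integral_sq_sub_le_log hm hη hη'
  · simp only [if_neg h1]
    exact ⟨_, fun η φ _ h => l2norm_le_of_integral_le h.nonneg (h.integral_sq_sub_le (by omega))⟩

/-- A family of deformed profiles with uniform bounds. -/
theorem exists_isProfile_family {m : ℕ} (hm : 1 ≤ m) : ∃ (C η₀ : ℝ) (Φ : ℝ → ℝ → ℝ), 0 < C ∧
    0 < η₀ ∧ η₀ ≤ 1 / 3 ∧ ∀ η ∈ Icc 0 η₀, IsProfile m C η (Φ η) := by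
  obtain ⟨C, η₀, hC, hη₀, h⟩ := exists_profile hm
  have hn : (0 : ℝ) < 4 * ((m : ℝ) + 1) := by positivity
  have hex : ∀ η, ∃ φ, η ∈ Icc 0 (min (min η₀ (1 / 3)) (min (1 / C) (1 / (4 * ((m : ℝ) + 1))))) →
      IsProfile m C η φ := by
    intro η
    by_cases hη : η ∈ Icc 0 (min (min η₀ (1 / 3)) (min (1 / C) (1 / (4 * ((m : ℝ) + 1)))))
    · obtain ⟨hη0, hη1⟩ := hη
      simp only [le_min_iff] at hη1
      obtain ⟨⟨h1, h2⟩, h3, h4⟩ := hη1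
      obtain ⟨φ, hφ, h5, h6, h7⟩ := h η hη0 h1
      rw [le_div_iff₀' hC] at h3
      rw [le_div_iff₀' hn] at h4
      exact ⟨φ, fun _ => ⟨hφ, hη0, hC, h3, h4, h5, h6, h7⟩⟩
    · exact ⟨0, fun h => absurd h hη⟩
  choose Φ hΦ using hex
  exact ⟨C, _, Φ, hC, by positivity, (min_le_left _ _).trans (min_le_right _ _), hΦ⟩

lemma IsProfile.exponent_zero {m : ℕ} {C : ℝ} {φ : ℝ → ℝ} (h : IsProfile m C 0 φ) {r : ℝ}
    (hr : 0 ≤ r) : φ r = 0 := by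
  simpa using h.quad_bound r hr

end CSS
end

/-! ### Assembly -/

theorem proposition4p3 (m : ℕ) (hm : 1 ≤ m) :
    ∃ ρ : ℝ → ℝ, CSS.IsGeneralizedMode m ρ ∧
    ∃ (B ηs : ℝ) (Qη Pη : ℝ → ℝ → ℝ), 1 < B ∧ 0 < ηs ∧
      -- smooth real profiles on (0,∞), with P positive and Q in L²
      (∀ η ∈ Set.Icc 0 ηs,
        ContDiffOn ℝ ∞ (Qη η) (Set.Ioi 0) ∧ ContDiffOn ℝ ∞ (Pη η) (Set.Ioi 0) ∧
        (∀ r > 0, 0 < Pη η r) ∧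
        CSS.SquareIntegrable (Qη η) ∧
        CSS.SquareIntegrable (fun r => Qη η r - CSS.Q m r)) ∧
      -- equations
      (∀ η ∈ Set.Icc 0 ηs, ∀ r > 0,
        CSS.Dplus m (Qη η) (Pη η) r = 0 ∧
        Qη η r = Real.exp (-(η * r ^ 2 / 4)) * Pη η r) ∧
      (∀ r > 0, Qη 0 r = CSS.Q m r ∧ Pη 0 r = CSS.Q m r) ∧
      -- refined uniform bounds
      (∃ C : ℝ, ∀ ℓ : ℕ, ℓ ≤ 1 → ∀ η ∈ Set.Icc 0 ηs, ∀ r > 0,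
        |iteratedDeriv ℓ (Qη η) r| ≤
          C * ((CSS.inner B η).indicator (fun s => (s ^ ℓ)⁻¹ * CSS.Q m s) r +
            (CSS.outer B η).indicator (fun s => (CSS.Rad B η ^ ℓ)⁻¹ * CSS.Q m (CSS.Rad B η) *
              Real.exp (-(η * s ^ 2 / 4))) r)) ∧
      -- uniform bounds
      (∃ C : ℝ, ∀ ℓ : ℕ, ℓ ≤ 1 → ∀ r > 0, ∀ η ∈ Set.Icc 0 ηs,
        |iteratedDeriv ℓ (Qη η) r| ≤ C * ((r ^ ℓ)⁻¹ * CSS.Q m r)) ∧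
      -- differentiability in η
      (∃ C : ℝ, ∀ η ∈ Set.Icc 0 ηs, ∀ r ∈ CSS.inner B η,
        |Qη η r - CSS.Q m r + η * (((m : ℝ) + 1) * ρ r)| ≤ C * (η ^ 2 * r ^ 4 * CSS.Q m r)) ∧
      -- subcritical mass
      ((fun η => CSS.planeIntegral (fun r => |Qη η r| ^ 2) -
          (CSS.planeIntegral (fun r => |CSS.Q m r| ^ 2) -
            η / (2 * ((m : ℝ) + 1)) * CSS.planeIntegral (fun r => |r * CSS.Q m r| ^ 2)))
        =o[𝓝[>] (0 : ℝ)] fun η => η) ∧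
      ((fun η => CSS.theta m (Qη η) -
          (((m : ℝ) + 1) - η / (8 * Real.pi * ((m : ℝ) + 1)) *
            CSS.planeIntegral (fun r => |r * CSS.Q m r| ^ 2)))
        =o[𝓝[>] (0 : ℝ)] fun η => η) ∧
      -- decay of P
      (∃ d : ℝ → ℝ,
        (∀ η ∈ Set.Icc 0 ηs,
          Tendsto (fun r => Real.log (Pη η r) / Real.log r) atTop (𝓝 (d η))) ∧
        ((fun η => d η - (-((m : ℝ) + 2) + η / (8 * Real.pi * ((m : ℝ) + 1)) *
            CSS.planeIntegral (fun r => |r * CSS.Q m r| ^ 2)))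
          =o[𝓝[>] (0 : ℝ)] fun η => η) ∧
        (∀ η ∈ Set.Ioc 0 ηs, -((m : ℝ) + 2) < d η)) ∧
      -- L² difference
      (∃ C : ℝ, ∀ η ∈ Set.Icc 0 ηs,
        CSS.l2norm (fun r => Qη η r - CSS.Q m r) ≤
          C * (if m = 1 then η * √|Real.log η| else η)) := by
  obtain ⟨φ₁, C₁, hC₁, h₁, hb₁⟩ := CSS.exists_firstVariation m
  obtain ⟨C, ηs, Φ, hC, hηs, hηs', hΦ⟩ := CSS.exists_isProfile_family hm
  obtain ⟨D, -, hD⟩ := CSS.exists_abs_sub_firstVariation_le m hC hC₁ h₁ hb₁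
  obtain ⟨K, hK⟩ := CSS.exists_l2norm_le hm C
  have hlim := CSS.isLittleO_angularLimit hm hηs hΦ
  have hn : (0 : ℝ) < (m : ℝ) + 1 := by positivity
  refine ⟨CSS.modeOf m φ₁, CSS.isGeneralizedMode_modeOf h₁ hb₁, 2, ηs,
    fun η => CSS.profQ m η (Φ η), fun η => CSS.profP m (Φ η), one_lt_two, hηs,
    fun η hη => ⟨(hΦ η hη).contDiffOn_profQ, (hΦ η hη).contDiffOn_profP,
      fun r hr => CSS.profP_pos m _ hr, (hΦ η hη).squareIntegrable_profQ,
      (hΦ η hη).squareIntegrable_sub⟩,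
    fun η hη r hr => ⟨(hΦ η hη).Dplus_eq_zero hr, CSS.profQ_eq m η (Φ η) r⟩,
    fun r hr => ?_, ⟨_, fun ℓ hℓ η hη r hr => (hΦ η hη).refined_bound hm hℓ hr⟩,
    ⟨_, fun ℓ hℓ r hr η hη => (hΦ η hη).uniform_bound hℓ hr⟩,
    ⟨(C + 1) ^ 2 + D, fun η hη r hr => (hΦ η hη).abs_sub_add_modeOf_le hr.1.le
      (hD η (Φ η) hη.1 (hΦ η hη).toIsPerturbation (hΦ η hη).quad_bound (hΦ η hη).bound r
        hr.1.le)⟩,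
    ?_, ?_, ⟨fun η => CSS.angularLimit m η (Φ η), fun η hη => (hΦ η hη).tendsto_log_profP, ?_,
      fun η hη => (hΦ η (Set.Ioc_subset_Icc_self hη)).lt_angularLimit hm hη.1⟩,
    ⟨K, fun η hη => hK η (Φ η) (hη.2.trans hηs') (hΦ η hη)⟩⟩
  · have h0 := (hΦ 0 ⟨le_rfl, hηs.le⟩).exponent_zero (le_of_lt hr)
    simp [CSS.profQ, CSS.profP, h0]
  -- The mass is 4π(m - d), so its error is -4π times that of d; likewise θ = -1 - d below.
  · refine (hlim.const_mul_left (-(4 * Real.pi))).congr_left fun η => ?_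
    rw [CSS.planeIntegral_profQ, CSS.planeIntegral_Q, CSS.planeIntegral_mul_Q]
    field_simp
    ring
  · refine (hlim.const_mul_left (-1)).congr_left fun η => ?_
    rw [CSS.theta, CSS.planeIntegral_profQ, CSS.planeIntegral_mul_Q]
    field_simp
    ring
  · refine hlim.congr_left fun η => ?_
    rw [CSS.planeIntegral_mul_Q]
    field_simp
    ring
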